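/- An instance $I=(G,c,(b_1,\dots,b_c))$ of the Budgeted Coloring Problem (BCP) consists of a finite simple undirected graph $G$, a number of colors $c\ge 0$ and non-negative integers $b_1,\dots,b_c$ (the budgets). It is a yes-instance if there is a proper coloring $\varphi:V(G)\to\{1,\dots,c\}$ with $|\varphi^{-1}(i)|\le b_i$ for all $1\le i\le c$. Let $|I|$ denote the size of the encoding of $I$ (adjacency matrix of $G$ and the list of the $c$ budgets, written in binary). A cluster graph is a disjoint union of cliques, a cluster vertex deletion set of $G$ is a set $S\subseteq V(G)$ such that $G-S$ is a cluster graph, and the cluster vertex deletion number of $G$ is the minimum size of such a set. Theorem. BCP parameterized by the cluster vertex deletion number $k$ of $G$ together with the number $d$ of clusters can be solved in time $\mathcal{O}^*(d^k\cdot 2^{k\log k})$. That is, there are a deterministic algorithm and constants $C,a\in\mathbb{N}$ such that, for every instance $I=(G,c,(b_1,\dots,b_c))$, the algorithm with input $I$ alone halts and correctly decides whether $I$ is a yes-instance, and, for every cluster vertex deletion set $S$ of $G$ of minimum size $k$, the number of steps it takes is at most $$C\cdot |I|^{a}\cdot d^k\cdot 2^{k\log_2 k},$$ where $d$ is the number of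 clusters (connected components) of $G-S$, and $d^0=1$ and $2^{k\log_2 k}=1$ for $k=0$. Steps are those of WHILE programs over binary trees, in which each elementary operation (forming a pair, taking a component of a pair, a test for the empty tree, an assignment) counts as one step. -/

import Mathlib

/-! ## The model of computation: WHILE programs over binary trees

Data are binary trees (`nil` / `cons`, as in Lisp). A program manipulates finitely many variables
holding trees by `nil`, `cons`, `hd`, `tl`, tests for `nil`, branching and loops. Every elementary
operation costs one step. There is no arithmetic, and each elementary operation is a pointer
operation on constantly many cells, so unit cost is honest: `t` steps are simulated by `O(t)` steps
of a pointer machine or random access machine whose words have `O(log (t + input size))` bits. -/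

namespace WhileLang

/-- Binary trees. -/
inductive Data : Type
  | nil : Data
  | cons (a b : Data) : Data

namespace Data

/-- The number of nodes (leaves included). -/
def size : Data → ℕ
  | nil => 1
  | cons a b => 1 + a.size + b.size

/-- First component (`nil` on `nil`). -/
def hd : Data → Data
  | nil => nil
  | cons a _ => a

/-- Second component (`nil` on `nil`). -/
def tl : Data → Data
  | nil => nil
  | cons _ b => b

/-- A list of trees, as a tree. -/
def ofList : List Data → Data
  | [] => nil
  | a :: l => cons a (ofList l)

/-- A bit, as a tree. -/
def ofBool : Bool → Data
  | false => nil
  | true => cons nil nil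

/-- A natural number in binary (least significant bit first), as a tree. -/
def ofNat (m : ℕ) : Data :=
  ofList (m.bits.map ofBool)

end Data

/-- A store assigns a tree to every variable; variables are numbered. -/
abbrev Store : Type := ℕ → Data

/-- Expressions. -/
inductive Expr : Type
  | var (x : ℕ) : Expr
  | nil : Expr
  | cons (e f : Expr) : Expr
  | hd (e : Expr) : Expr
  | tl (e : Expr) : Expr

namespace Expr

/-- Value of an expression in a store. -/
def eval (s : Store) : Expr → Data
  | var x => s x
  | nil => Data.nil
  | cons e f => Data.cons (e.eval s) (f.eval s)
  | hd e => (e.eval s).hd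
  | tl e => (e.eval s).tl

/-- Number of steps for evaluating an expression: one per operation in it. -/
def cost : Expr → ℕ
  | var _ => 1
  | nil => 1
  | cons e f => 1 + e.cost + f.cost
  | hd e => 1 + e.cost
  | tl e => 1 + e.cost

end Expr

/-- Programs. -/
inductive Prog : Type
  | assign (x : ℕ) (e : Expr) : Prog
  | seq (p q : Prog) : Prog
  | cond (e : Expr) (p q : Prog) : Prog
  | loop (e : Expr) (p : Prog) : Prog

/-- `Runs p s s' t`: started in the store `s`, the program `p` halts in the store `s'` after exactly
`t` steps. A test succeeds when the value tested is not `nil`; `loop e p` is "while `e` do `p`". -/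
inductive Runs : Prog → Store → Store → ℕ → Prop
  | assign (x : ℕ) (e : Expr) (s : Store) :
      Runs (.assign x e) s (Function.update s x (e.eval s)) (1 + e.cost)
  | seq {p q : Prog} {s s₁ s₂ : Store} {t₁ t₂ : ℕ} :
      Runs p s s₁ t₁ → Runs q s₁ s₂ t₂ → Runs (.seq p q) s s₂ (t₁ + t₂)
  | cond_true {e : Expr} {p q : Prog} {s s' : Store} {t : ℕ} :
      e.eval s ≠ Data.nil → Runs p s s' t → Runs (.cond e p q) s s' (1 + e.cost + t)
  | cond_false {e : Expr} {p q : Prog} {s s' : Store} {t : ℕ} :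
      e.eval s = Data.nil → Runs q s s' t → Runs (.cond e p q) s s' (1 + e.cost + t)
  | loop_true {e : Expr} {p : Prog} {s s₁ s₂ : Store} {t₁ t₂ : ℕ} :
      e.eval s ≠ Data.nil → Runs p s s₁ t₁ → Runs (.loop e p) s₁ s₂ t₂ →
      Runs (.loop e p) s s₂ (1 + e.cost + t₁ + t₂)
  | loop_false {e : Expr} {p : Prog} {s : Store} :
      e.eval s = Data.nil → Runs (.loop e p) s s (1 + e.cost)

/-- Programs are deterministic: result and running time are determined by the initial store. -/
theorem Runs.unique {p : Prog} {s s₁ s₂ : Store} {t₁ t₂ : ℕ}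
    (h₁ : Runs p s s₁ t₁) (h₂ : Runs p s s₂ t₂) : s₁ = s₂ ∧ t₁ = t₂ := by
  induction h₁ generalizing s₂ t₂ with
  | assign x e s => cases h₂; exact ⟨rfl, rfl⟩
  | seq _ _ ih ih' =>
    cases h₂ with
    | seq a b =>
      obtain ⟨rfl, rfl⟩ := ih a
      obtain ⟨rfl, rfl⟩ := ih' b
      exact ⟨rfl, rfl⟩
  | cond_true h _ ih =>
    cases h₂ with
    | cond_true _ a => obtain ⟨rfl, rfl⟩ := ih a; exact ⟨rfl, rfl⟩
    | cond_false h' _ => exact absurd h' h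
  | cond_false h _ ih =>
    cases h₂ with
    | cond_true h' _ => exact absurd h h'
    | cond_false _ a => obtain ⟨rfl, rfl⟩ := ih a; exact ⟨rfl, rfl⟩
  | loop_true h _ _ ih ih' =>
    cases h₂ with
    | loop_true _ a b =>
      obtain ⟨rfl, rfl⟩ := ih a
      obtain ⟨rfl, rfl⟩ := ih' b
      exact ⟨rfl, rfl⟩
    | loop_false h' => exact absurd h' h
  | loop_false h =>
    cases h₂ with
    | loop_true h' _ _ => exact absurd h h'
    | loop_false _ => exact ⟨rfl, rfl⟩

/-- The initial store: the input in variable `0`, all other variables `nil`. -/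
def initStore (input : Data) : Store :=
  fun x => if x = 0 then input else Data.nil

/-- `Decides p input answer t`: on the given input, `p` halts after exactly `t` steps, and it accepts
(that is, leaves a value other than `nil` in variable `0`) if and only if `answer` holds. -/
def Decides (p : Prog) (input : Data) (answer : Prop) (t : ℕ) : Prop :=
  ∃ s : Store, Runs p (initStore input) s t ∧ (s 0 ≠ Data.nil ↔ answer)

end WhileLang

/-! ## The Budgeted Coloring Problem -/

/-- An instance: a finite simple graph (on `n` labelled vertices), a number `c` of colors and a list
of `c` budgets. -/
structure BCPInstance : Type where
  n : ℕ
  G : SimpleGraph (Fin n)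
  c : ℕ
  b : Fin c → ℕ

namespace BCPInstance

/-- There is a proper coloring with `c` colors that uses the `i`-th color at most `b i` times. -/
def IsYes (I : BCPInstance) : Prop :=
  ∃ φ : I.G.Coloring (Fin I.c), ∀ i : Fin I.c, (φ.colorClass i).ncard ≤ I.b i

open Classical in
/-- The input given to a program: the adjacency matrix of the graph, and the list of the budgets in
binary. -/
noncomputable def encode (I : BCPInstance) : WhileLang.Data :=
  .cons
    (.ofList (List.ofFn fun u : Fin I.n =>
      .ofList (List.ofFn fun v : Fin I.n => .ofBool (decide (I.G.Adj u v)))))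
    (.ofList (List.ofFn fun i : Fin I.c => .ofNat (I.b i)))

end BCPInstance

/-! ## Cluster vertex deletion -/

/-- A cluster graph is a disjoint union of cliques: every connected component is a clique. -/
def IsClusterGraph {V : Type*} (G : SimpleGraph V) : Prop :=
  ∀ u v : V, G.Reachable u v → u ≠ v → G.Adj u v

/-- The graph `G - S`. -/
abbrev deleteVerts {V : Type*} (G : SimpleGraph V) (S : Finset V) :
    SimpleGraph ((↑S : Set V)ᶜ : Set V) :=
  G.induce ((↑S : Set V)ᶜ)

/-- `S` is a cluster vertex deletion set: `G - S` is a cluster graph. -/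
def IsClusterDeletionSet {V : Type*} (G : SimpleGraph V) (S : Finset V) : Prop :=
  IsClusterGraph (deleteVerts G S)

/-- The cluster vertex deletion number: the minimum size of a cluster vertex deletion set. -/
noncomputable def cvdNumber {V : Type*} (G : SimpleGraph V) : ℕ :=
  sInf {k : ℕ | ∃ S : Finset V, IsClusterDeletionSet G S ∧ S.card = k}

/-- The number of clusters (connected components) of `G - S`. -/
noncomputable def numClusters {V : Type*} (G : SimpleGraph V) (S : Finset V) : ℕ :=
  Nat.card (deleteVerts G S).ConnectedComponent

/-! Let `X` be a minimum cluster deletion set, of size `k`, and let `d` be the number of clusters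
that remain. A class of a proper coloring meets each cluster at most once, so it has at most `d`
vertices outside `X`. For the vertices of `X` in turn, guess either an earlier vertex with the same
color or, if a new class is opened, the number of its vertices outside `X`. The `i`-th vertex (from
`0`) has `d + 1 + i` options, and the product of these is at most `d ^ k * (k + 1)!`, hence at most
`(k + 1) * (d ^ k * k ^ k)`, as `d ≥ 1` whenever `k > 0` (`prod_radices_le`, `reps_pos_of_min`).

A guess fixes the sizes of the classes that meet `X`, and then colors can be chosen greedily: each
new class takes an unused color of least budget among those that can hold it. Swapping two colors
turns any valid coloring into one that agrees with the greedy choices (`IsValid.swap`,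
`exists_colors_eq`). Once `X` is colored, the rest is a bipartite matching problem between the
vertices outside `X` and the pairs (cluster, color); dummies that block surplus pairs enforce the
budgets (`extendable_eq_true_iff`). The matching is decided by an auction with unit bids, whose
prices stay bounded whenever a full matching exists (`AuctionInv.price_le`, `auction_eq_true_iff`).

The set `X` is found by branching on induced paths with three vertices, one of which lies in every
deletion set. This gives `3 ^ k` branches, and `3 ^ k ≤ 27 * k ^ k`. An extra most significant digit
bounds the number of clusters, so the first success has at most as many clusters as any given
minimum set `S` (`exists_branch`, `isDeletion_search`); this is needed because the time bound refers
to an arbitrary such `S`.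

For the step count, `Poly` is a class of functions closed under composition, case distinction and
folds with bounded accumulators. Both exponential phases are instances of `exists_search`, a mixed
radix counter whose cost is the number of tuples times a polynomial. Budgets are capped at the
number of vertices, so that they can be handled in unary. -/

namespace WhileLang

/-! ## Programs with a frame -/

/-- Started with `x` in variable `k`, the program `P k` leaves `y` in variable `k` after at most `t`
steps and does not change the variables below `k`. -/
def Maps (P : ℕ → Prog) (x y : Data) (t : ℕ) : Prop :=
  ∀ (k : ℕ) (s : Store), s k = x →
    ∃ (s' : Store) (t' : ℕ), t' ≤ t ∧ Runs (P k) s s' t' ∧ s' k = y ∧ ∀ j < k, s' j = s j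

namespace Maps

theorem mono {P : ℕ → Prog} {x y : Data} {t u : ℕ} (h : Maps P x y t) (htu : t ≤ u) :
    Maps P x y u := by
  intro k s hs
  obtain ⟨s', t', ht, hr, hy, hj⟩ := h k s hs
  exact ⟨s', t', ht.trans htu, hr, hy, hj⟩

/-- Replace the content of a variable by the value of an expression in it. -/
def exprProg (e : Expr → Expr) (k : ℕ) : Prog := .assign k (e (.var k))

theorem skip (x : Data) : Maps (exprProg id) x x 2 := by
  intro k s hs
  exact ⟨_, _, le_rfl, Runs.assign k (.var k) s, by simp [Expr.eval, hs],
    fun j hj => by simp [Function.update, hj.ne]⟩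

theorem hd (x : Data) : Maps (exprProg .hd) x x.hd 3 := by
  intro k s hs
  exact ⟨_, _, le_rfl, Runs.assign k (.hd (.var k)) s, by simp [Expr.eval, hs],
    fun j hj => by simp [Function.update, hj.ne]⟩

theorem tl (x : Data) : Maps (exprProg .tl) x x.tl 3 := by
  intro k s hs
  exact ⟨_, _, le_rfl, Runs.assign k (.tl (.var k)) s, by simp [Expr.eval, hs],
    fun j hj => by simp [Function.update, hj.ne]⟩

/-- An expression with a given value. -/
def constExpr : Data → Expr
  | .nil => .nil
  | .cons a b => .cons (constExpr a) (constExpr b)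

theorem eval_constExpr (s : Store) (y : Data) : (constExpr y).eval s = y := by
  induction y with
  | nil => rfl
  | cons a b iha ihb => simp [constExpr, Expr.eval, iha, ihb]

theorem const (x y : Data) :
    Maps (exprProg fun _ => constExpr y) x y (1 + (constExpr y).cost) := by
  intro k s hs
  exact ⟨_, _, le_rfl, Runs.assign k (constExpr y) s, by simp [eval_constExpr],
    fun j hj => by simp [Function.update, hj.ne]⟩

def seqProg (P Q : ℕ → Prog) (k : ℕ) : Prog := .seq (P k) (Q k)

theorem seq {P Q : ℕ → Prog} {x y z : Data} {t u : ℕ} (hP : Maps P x y t) (hQ : Maps Q y z u) :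
    Maps (seqProg P Q) x z (t + u) := by
  intro k s hs
  obtain ⟨s₁, t₁, ht₁, hr₁, hy₁, hj₁⟩ := hP k s hs
  obtain ⟨s₂, t₂, ht₂, hr₂, hy₂, hj₂⟩ := hQ k s₁ hy₁
  exact ⟨s₂, _, add_le_add ht₁ ht₂, hr₁.seq hr₂, hy₂, fun j hj => (hj₂ j hj).trans (hj₁ j hj)⟩

/-- `P` works from variable `k + 1` upwards and `Q` from `k + 2`, so the frame condition of `Maps`
protects the input in `k` and the first result in `k + 1`. -/
def pairProg (P Q : ℕ → Prog) (k : ℕ) : Prog :=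
  .seq (.assign (k + 1) (.var k)) <| .seq (P (k + 1)) <| .seq (.assign (k + 2) (.var k)) <|
    .seq (Q (k + 2)) <| .assign k (.cons (.var (k + 1)) (.var (k + 2)))

theorem pair {P Q : ℕ → Prog} {x y z : Data} {t u : ℕ} (hP : Maps P x y t) (hQ : Maps Q x z u) :
    Maps (pairProg P Q) x (.cons y z) (t + u + 8) := by
  intro k s hs
  obtain ⟨s₁, t₁, ht₁, hr₁, hy₁, hj₁⟩ :=
    hP (k + 1) (Function.update s (k + 1) ((Expr.var k).eval s)) (by simp [Expr.eval, hs])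
  have hk₁ : s₁ k = x := by rw [hj₁ k (by omega)]; simp [Function.update, hs]
  obtain ⟨s₂, t₂, ht₂, hr₂, hy₂, hj₂⟩ :=
    hQ (k + 2) (Function.update s₁ (k + 2) ((Expr.var k).eval s₁)) (by simp [Expr.eval, hk₁])
  have hk₂ : s₂ (k + 1) = y := by rw [hj₂ _ (by omega)]; simp [Function.update, hy₁]
  refine ⟨_, _, ?_, (Runs.assign _ _ _).seq (hr₁.seq ((Runs.assign _ _ _).seq
    (hr₂.seq (Runs.assign _ _ _)))), ?_, ?_⟩
  · simp only [Expr.cost]; omega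
  · simp [Expr.eval, hy₂, hk₂]
  · intro j hj
    have h₁ := hj₁ j (by omega)
    have h₂ := hj₂ j (by omega)
    rw [Function.update_of_ne hj.ne, h₂, Function.update_of_ne (by omega), h₁,
      Function.update_of_ne (by omega)]

/-- The value tested is computed in variable `k + 1`. `F` is run on the original input, whereas `G`
gets the input paired with that value. -/
def casesProg (R F G : ℕ → Prog) (k : ℕ) : Prog :=
  .seq (.assign (k + 1) (.var k)) <| .seq (R (k + 1)) <|
    .cond (.var (k + 1))
      (.seq (.assign (k + 1) (.cons (.var k) (.var (k + 1)))) <|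
        .seq (G (k + 1)) (.assign k (.var (k + 1))))
      (F k)

theorem cases_nil {R F G : ℕ → Prog} {x y : Data} {t u : ℕ} (hR : Maps R x .nil t)
    (hF : Maps F x y u) : Maps (casesProg R F G) x y (t + u + 4) := by
  intro k s hs
  obtain ⟨s₁, t₁, ht₁, hr₁, hy₁, hj₁⟩ :=
    hR (k + 1) (Function.update s (k + 1) ((Expr.var k).eval s)) (by simp [Expr.eval, hs])
  have hk₁ : s₁ k = x := by rw [hj₁ k (by omega)]; simp [Function.update, hs]
  obtain ⟨s₂, t₂, ht₂, hr₂, hy₂, hj₂⟩ := hF k s₁ hk₁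
  refine ⟨_, _, ?_, (Runs.assign _ _ _).seq (hr₁.seq (Runs.cond_false hy₁ hr₂)), hy₂, ?_⟩
  · simp only [Expr.cost]; omega
  · intro j hj
    rw [hj₂ j hj, hj₁ j (by omega), Function.update_of_ne (by omega)]

theorem cases_cons {R F G : ℕ → Prog} {x y a b : Data} {t u : ℕ} (hR : Maps R x (.cons a b) t)
    (hG : Maps G (.cons x (.cons a b)) y u) : Maps (casesProg R F G) x y (t + u + 10) := by
  intro k s hs
  obtain ⟨s₁, t₁, ht₁, hr₁, hy₁, hj₁⟩ :=
    hR (k + 1) (Function.update s (k + 1) ((Expr.var k).eval s)) (by simp [Expr.eval, hs])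
  have hk₁ : s₁ k = x := by rw [hj₁ k (by omega)]; simp [Function.update, hs]
  obtain ⟨s₂, t₂, ht₂, hr₂, hy₂, hj₂⟩ := hG (k + 1) (Function.update s₁ (k + 1)
    ((Expr.cons (.var k) (.var (k + 1))).eval s₁)) (by simp [Expr.eval, hk₁, hy₁])
  refine ⟨_, _, ?_, (Runs.assign _ _ _).seq (hr₁.seq (Runs.cond_true ?_
    ((Runs.assign _ _ _).seq (hr₂.seq (Runs.assign _ _ _))))), ?_, ?_⟩
  · simp only [Expr.cost]; omega
  · simp [Expr.eval, hy₁]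
  · simp [Expr.eval, hy₂]
  · intro j hj
    rw [Function.update_of_ne hj.ne, hj₂ j (by omega), Function.update_of_ne (by omega),
      hj₁ j (by omega), Function.update_of_ne (by omega)]

/-- Iterate while the first component is not `nil`. -/
def whileProg (P : ℕ → Prog) (k : ℕ) : Prog := .loop (.hd (.var k)) (P k)

theorem while_loop {P : ℕ → Prog} {u : ℕ} (T : ℕ) (x : ℕ → Data)
    (hP : ∀ i < T, Maps P (x i) (x (i + 1)) u) (h : ∀ i < T, (x i).hd ≠ .nil)
    (hT : (x T).hd = .nil) : Maps (whileProg P) (x 0) (x T) (T * (u + 3) + 3) := by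
  induction T generalizing x with
  | zero =>
    intro k s hs
    refine ⟨s, _, ?_, Runs.loop_false ?_, hs, fun _ _ => rfl⟩
    · simp [Expr.cost]
    · simpa [Expr.eval, hs] using hT
  | succ T ih =>
    intro k s hs
    obtain ⟨s₁, t₁, ht₁, hr₁, hy₁, hj₁⟩ := hP 0 (by omega) k s hs
    obtain ⟨s₂, t₂, ht₂, hr₂, hy₂, hj₂⟩ := ih (fun i => x (i + 1))
      (fun i hi => hP (i + 1) (by omega)) (fun i hi => h (i + 1) (by omega)) hT k s₁ hy₁
    refine ⟨s₂, _, ?_, Runs.loop_true ?_ hr₁ hr₂, hy₂,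
      fun j hj => (hj₂ j hj).trans (hj₁ j hj)⟩
    · simp only [Expr.cost]; rw [add_mul]; omega
    · simpa [Expr.eval, hs] using h 0 (by omega)

end Maps

/-! ## Encodings of types as trees -/

/-- A representation of the elements of a type by trees. -/
class Enc (α : Type) where
  /-- The tree that represents an element. -/
  enc : α → Data


open Enc

instance : Enc Unit := ⟨fun _ => .nil⟩

instance : Enc Bool := ⟨Data.ofBool⟩

/-- Natural numbers in unary. -/
def encNat : ℕ → Data
  | 0 => .nil
  | n + 1 => .cons .nil (encNat n)

instance : Enc ℕ := ⟨encNat⟩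

def encList {α : Type} [Enc α] : List α → Data
  | [] => .nil
  | a :: l => .cons (enc a) (encList l)

instance {α : Type} [Enc α] : Enc (List α) := ⟨encList⟩

instance {α β : Type} [Enc α] [Enc β] : Enc (α × β) := ⟨fun p => .cons (enc p.1) (enc p.2)⟩

/-- The size of the representation. -/
def sz {α : Type} [Enc α] (x : α) : ℕ := (enc x).size

section Size

variable {α β : Type} [Enc α] [Enc β]

theorem enc_pair (a : α) (b : β) : enc (a, b) = .cons (enc a) (enc b) := rfl
theorem enc_list_nil : enc ([] : List α) = .nil := rfl
theorem enc_list_cons (a : α) (l : List α) : enc (a :: l) = .cons (enc a) (enc l) := rfl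
theorem enc_nat_succ (n : ℕ) : enc (n + 1) = .cons .nil (enc n) := rfl
theorem enc_true : enc true = .cons .nil .nil := rfl
theorem enc_false : enc false = .nil := rfl

theorem sz_pos (x : α) : 1 ≤ sz x := by
  unfold sz; cases enc x <;> simp [Data.size]; omega

@[simp] theorem sz_pair (a : α) (b : β) : sz (a, b) = 1 + sz a + sz b := rfl
theorem sz_prod (p : α × β) : sz p = 1 + sz p.1 + sz p.2 := rfl
@[simp] theorem sz_list_nil : sz ([] : List α) = 1 := rfl
@[simp] theorem sz_list_cons (a : α) (l : List α) : sz (a :: l) = 1 + sz a + sz l := rfl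
@[simp] theorem sz_nat (n : ℕ) : sz n = 2 * n + 1 := by
  induction n with
  | zero => rfl
  | succ n ih =>
    have : sz (n + 1) = 1 + 1 + sz n := rfl
    omega

theorem sz_fst_le (p : α × β) : sz p.1 ≤ sz p := by rw [sz_prod p]; omega
theorem sz_snd_le (p : α × β) : sz p.2 ≤ sz p := by rw [sz_prod p]; omega

theorem length_lt_sz (l : List α) : l.length < sz l := by
  induction l with
  | nil => simp
  | cons a l ih => simp; omega

theorem sz_le_of_mem {l : List α} {a : α} (h : a ∈ l) : sz a < sz l := by
  induction l with
  | nil => simp at h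
  | cons b l ih =>
    rcases List.mem_cons.1 h with rfl | h
    · simp; have := sz_pos l; omega
    · have := ih h; simp; omega

theorem sz_append (l l' : List α) : sz (l ++ l') + 1 = sz l + sz l' := by
  induction l with
  | nil => simp; omega
  | cons a l ih => simp; omega

theorem sz_list_le {l : List α} {M : ℕ} (h : ∀ a ∈ l, sz a ≤ M) :
    sz l ≤ 1 + l.length * (1 + M) := by
  induction l with
  | nil => simp
  | cons a l ih =>
    have h₁ := ih fun b hb => h b (List.mem_cons_of_mem _ hb)
    have h₂ := h a List.mem_cons_self
    simp only [sz_list_cons, List.length_cons, add_mul]; omega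

end Size

/-! ## Polynomially bounded functions -/

/-- `g` is bounded by a polynomial in the size of the argument. -/
def PolyBdd {α : Type} [Enc α] (g : α → ℕ) : Prop := ∃ C a : ℕ, ∀ x, g x ≤ C * sz x ^ a

namespace PolyBdd

variable {α β : Type} [Enc α] [Enc β] {f g : α → ℕ}

theorem mono (hg : PolyBdd g) (h : ∀ x, f x ≤ g x) : PolyBdd f := by
  obtain ⟨C, a, hg⟩ := hg
  exact ⟨C, a, fun x => (h x).trans (hg x)⟩

theorem const (c : ℕ) : PolyBdd fun _ : α => c := ⟨c, 0, fun x => by simp⟩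

theorem size : PolyBdd fun x : α => sz x := ⟨1, 1, fun x => by simp⟩

theorem add (hf : PolyBdd f) (hg : PolyBdd g) : PolyBdd fun x => f x + g x := by
  obtain ⟨C, a, hf⟩ := hf
  obtain ⟨D, b, hg⟩ := hg
  refine ⟨C + D, a + b, fun x => ?_⟩
  have h := sz_pos x
  rw [add_mul]
  exact add_le_add ((hf x).trans (Nat.mul_le_mul_left _ (Nat.pow_le_pow_right h (by omega))))
    ((hg x).trans (Nat.mul_le_mul_left _ (Nat.pow_le_pow_right h (by omega))))

theorem mul (hf : PolyBdd f) (hg : PolyBdd g) : PolyBdd fun x => f x * g x := by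
  obtain ⟨C, a, hf⟩ := hf
  obtain ⟨D, b, hg⟩ := hg
  refine ⟨C * D, a + b, fun x => ?_⟩
  calc f x * g x ≤ (C * sz x ^ a) * (D * sz x ^ b) := Nat.mul_le_mul (hf x) (hg x)
    _ = _ := by ring

theorem pow (hf : PolyBdd f) (n : ℕ) : PolyBdd fun x => f x ^ n := by
  induction n with
  | zero => simpa using const 1
  | succ n ih => simpa [pow_succ] using ih.mul hf

theorem comp {h : β → ℕ} {e : α → β} (hh : PolyBdd h) (he : PolyBdd fun x => sz (e x)) :
    PolyBdd fun x => h (e x) := by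
  obtain ⟨C, a, hh⟩ := hh
  exact ((const C).mul (he.pow a)).mono fun x => hh (e x)

end PolyBdd

/-- `f` is computed by a program in polynomial time, and its values have polynomial size. -/
@[fun_prop]
def Poly {α β : Type} [Enc α] [Enc β] (f : α → β) : Prop :=
  ∃ (P : ℕ → Prog) (τ : α → ℕ), PolyBdd τ ∧ PolyBdd (fun x => sz (f x)) ∧
    ∀ x, Maps P (enc x) (enc (f x)) (τ x)

/-! ### Closure properties of polynomial time functions. -/

namespace Poly

variable {α β γ ι σ : Type} [Enc α] [Enc β] [Enc γ] [Enc ι] [Enc σ]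

theorem polyBdd_sz {f : α → β} (hf : Poly f) : PolyBdd fun x => sz (f x) := by
  obtain ⟨P, τ, -, h, -⟩ := hf
  exact h

/-- A change of type that keeps the tree is free. This applies to a pair read as a nonempty list, a
list of units read as a unary number, and a bit read as a list of length at most one. -/
theorem of_enc_eq {f : α → β} (h : ∀ x, enc (f x) = enc x) : Poly f := by
  refine ⟨Maps.exprProg _root_.id, fun _ => 2, PolyBdd.const 2, ?_, fun x => ?_⟩
  · exact PolyBdd.size.mono fun x => by simp [sz, h]
  · rw [h]; exact Maps.skip _

@[fun_prop]
theorem id : Poly fun x : α => x := of_enc_eq fun _ => rfl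

@[fun_prop]
theorem const (b : β) : Poly fun _ : α => b :=
  ⟨_, _, PolyBdd.const _, PolyBdd.const _, fun x => Maps.const (enc x) (enc b)⟩

@[fun_prop]
theorem comp {g : β → γ} {f : α → β} (hg : Poly g) (hf : Poly f) : Poly fun x => g (f x) := by
  obtain ⟨P, τ, hτ, hs, hP⟩ := hf
  obtain ⟨Q, υ, hυ, hs', hQ⟩ := hg
  exact ⟨_, _, hτ.add (hυ.comp hs), hs'.comp hs, fun x => (hP x).seq (hQ (f x))⟩

theorem congr {f g : α → β} (hf : Poly f) (h : ∀ x, g x = f x) : Poly g := by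
  rwa [show g = f from funext h]

@[fun_prop]
theorem prodMk {f : α → β} {g : α → γ} (hf : Poly f) (hg : Poly g) :
    Poly fun x => (f x, g x) := by
  obtain ⟨P, τ, hτ, hs, hP⟩ := hf
  obtain ⟨Q, υ, hυ, hs', hQ⟩ := hg
  exact ⟨_, _, (hτ.add hυ).add (.const 8), ((PolyBdd.const 1).add hs).add hs',
    fun x => (hP x).pair (hQ x)⟩

@[fun_prop]
theorem fst : Poly (Prod.fst : α × β → α) :=
  ⟨_, _, PolyBdd.const 3, PolyBdd.size.mono sz_fst_le, fun x => Maps.hd (enc x)⟩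

@[fun_prop]
theorem snd : Poly (Prod.snd : α × β → β) :=
  ⟨_, _, PolyBdd.const 3, PolyBdd.size.mono sz_snd_le, fun x => Maps.tl (enc x)⟩

@[fun_prop]
theorem fst' {f : α → β × γ} (hf : Poly f) : Poly fun x => (f x).1 := fst.comp hf

@[fun_prop]
theorem snd' {f : α → β × γ} (hf : Poly f) : Poly fun x => (f x).2 := snd.comp hf

@[fun_prop]
theorem cons {f : α → β} {g : α → List β} (hf : Poly f) (hg : Poly g) :
    Poly fun x => f x :: g x :=
  (of_enc_eq (f := fun p : β × List β => p.1 :: p.2) fun _ => rfl).comp (hf.prodMk hg)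

@[fun_prop]
theorem tail {f : α → List β} (hf : Poly f) : Poly fun x => (f x).tail := by
  have : Poly (List.tail : List β → List β) := by
    refine ⟨Maps.exprProg .tl, _, PolyBdd.const 3, PolyBdd.size.mono fun x => ?_, fun x => ?_⟩
    · cases x <;> simp
    · have := Maps.tl (enc x)
      cases x <;> exact this
  exact this.comp hf

end Poly

/-- Case distinction on a list. -/
def listCases {β γ : Type} (l : List β) (c : γ) (g : β → List β → γ) : γ :=
  match l with
  | [] => c
  | b :: l => g b l

@[simp] theorem listCases_nil {β γ : Type} (c : γ) (g : β → List β → γ) :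
    listCases [] c g = c := rfl
@[simp] theorem listCases_cons {β γ : Type} (b : β) (l : List β) (c : γ) (g : β → List β → γ) :
    listCases (b :: l) c g = g b l := rfl

namespace Poly

variable {α β γ ι σ : Type} [Enc α] [Enc β] [Enc γ] [Enc ι] [Enc σ]

@[fun_prop]
theorem listCases {L : α → List β} {f : α → γ} {g : α → β → List β → γ} (hL : Poly L)
    (hf : Poly f) (hg : Poly fun p : α × (β × List β) => g p.1 p.2.1 p.2.2) :
    Poly fun x => listCases (L x) (f x) (g x) := by
  obtain ⟨R, ρ, hρ, hsL, hR⟩ := hL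
  obtain ⟨P, τ, hτ, hs, hP⟩ := hf
  obtain ⟨Q, υ, hυ, hs', hQ⟩ := hg
  -- The pair `(b, l)` and the list `b :: l` have the same size, so a bound in the size of `(x, (b,
  -- l))` is one in the sizes of `x` and `L x`.
  have key : ∀ e : α × (β × List β) → ℕ, PolyBdd e →
      PolyBdd fun x => WhileLang.listCases (L x) 0 fun b l => e (x, (b, l)) := by
    rintro e ⟨C, a, he⟩
    refine ((PolyBdd.const C).mul
      ((((PolyBdd.const 1).add PolyBdd.size).add hsL).pow a)).mono fun x => ?_
    cases h : L x with
    | nil => simp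
    | cons b l =>
      refine (he _).trans (Nat.mul_le_mul_left _ (Nat.pow_le_pow_left ?_ _))
      simp
  refine ⟨Maps.casesProg R P Q, _, ((hρ.add hτ).add (key υ hυ)).add (.const 10),
    (hs.add (key _ hs')).mono fun x => ?_, fun x => ?_⟩
  · beta_reduce
    cases L x with
    | nil => simp
    | cons b l => simp
  · have hR := hR x
    beta_reduce
    cases h : L x with
    | nil =>
      rw [h] at hR
      exact (hR.cases_nil (hP x)).mono (by simp only [listCases_nil]; omega)
    | cons b l =>
      rw [h, enc_list_cons] at hR
      exact (hR.cases_cons (hQ (x, b, l))).mono (by simp only [listCases_cons]; omega)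

@[fun_prop]
theorem cond {c : α → Bool} {f g : α → β} (hc : Poly c) (hf : Poly f) (hg : Poly g) :
    Poly fun x => bif c x then f x else g x := by
  let e : Bool → List Unit := fun b => bif b then [()] else []
  have he : Poly e := of_enc_eq fun b => by cases b <;> rfl
  refine (listCases (he.comp hc) hg (g := fun x _ _ => f x) (hf.comp fst)).congr fun x => ?_
  cases c x <;> rfl

/-- Folding over a list, when the accumulator stays polynomially bounded. -/
theorem foldl {L : α → List ι} {a₀ : α → σ} {step : α → σ → ι → σ} (hL : Poly L)
    (ha : Poly a₀) (hstep : Poly fun p : α × (σ × ι) => step p.1 p.2.1 p.2.2) {M : α → ℕ}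
    (hM : PolyBdd M)
    (hb : ∀ x l₁ l₂, L x = l₁ ++ l₂ → sz (l₁.foldl (step x) (a₀ x)) ≤ M x) :
    Poly fun x => (L x).foldl (step x) (a₀ x) := by
  -- The loop state is the remaining list, the accumulator and the input. The list comes first
  -- because the loop tests the first component, which is `nil` exactly when the list is exhausted.
  let body : List ι × (σ × α) → List ι × (σ × α) := fun p =>
    WhileLang.listCases p.1 p fun i l => (l, (step p.2.2 p.2.1 i, p.2.2))
  have hbody : Poly body := by
    refine listCases (by fun_prop) (by fun_prop) ?_
    refine prodMk (by fun_prop) (prodMk ?_ (by fun_prop))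
    exact hstep.comp (f := fun p : (List ι × (σ × α)) × (ι × List ι) =>
      (p.1.2.2, (p.1.2.1, p.2.1))) (by fun_prop)
  have hinit : Poly fun x => (L x, (a₀ x, x)) := by fun_prop
  have hfin : Poly fun p : List ι × (σ × α) => p.2.1 := by fun_prop
  obtain ⟨P₀, τ₀, hτ₀, hs₀, hP₀⟩ := hinit
  obtain ⟨P₁, τ₁, ⟨C, a, hτ₁⟩, -, hP₁⟩ := hbody
  obtain ⟨P₂, τ₂, ⟨C', a', hτ₂⟩, -, hP₂⟩ := hfin
  have hsL := hL.polyBdd_sz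
  have hbig := (((PolyBdd.const 2).add hsL).add hM).add PolyBdd.size
  refine ⟨Maps.seqProg P₀ (Maps.seqProg (Maps.whileProg P₁) P₂), _,
    hτ₀.add (((hsL.mul (((PolyBdd.const C).mul (hbig.pow a)).add (.const 3))).add (.const 3)).add
      ((PolyBdd.const C').mul (hbig.pow a'))),
    hM.mono fun x => hb x (L x) [] (by simp), fun x => (hP₀ x).seq ?_⟩
  let st : ℕ → List ι × (σ × α) := fun i =>
    ((L x).drop i, (((L x).take i).foldl (step x) (a₀ x), x))
  have hst : ∀ i, sz (st i) ≤ 2 + sz (L x) + M x + sz x := by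
    intro i
    have h₁ := hb x ((L x).take i) ((L x).drop i) (by simp)
    have h₂ := sz_append ((L x).take i) ((L x).drop i)
    rw [List.take_append_drop] at h₂
    have h₃ := sz_pos ((L x).take i)
    simp only [st, sz_pair]; omega
  have hloop : Maps (Maps.whileProg P₁) (enc (st 0)) (enc (st (L x).length))
      ((L x).length * (C * (2 + sz (L x) + M x + sz x) ^ a + 3) + 3) := by
    refine Maps.while_loop (L x).length (fun i => enc (st i)) (fun i hi => ?_) (fun i hi => ?_) ?_
    · have h : body (st i) = st (i + 1) := by
        simp only [body, st, List.drop_eq_getElem_cons hi, listCases_cons,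
          List.take_succ_eq_append_getElem hi, List.foldl_append, List.foldl_cons, List.foldl_nil]
      rw [← h]
      exact (hP₁ (st i)).mono ((hτ₁ _).trans
        (Nat.mul_le_mul_left _ (Nat.pow_le_pow_left (hst i) _)))
    · simp only [st, List.drop_eq_getElem_cons hi, enc_pair, enc_list_cons, Data.hd]
      simp
    · simp [st, enc_pair, enc_list_nil, Data.hd]
  have h₂ := (hP₂ (st (L x).length)).mono ((hτ₂ _).trans
        (Nat.mul_le_mul_left _ (Nat.pow_le_pow_left (hst _) _)))
  have h₁ : st 0 = (L x, (a₀ x, x)) := by simp [st]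
  have h₃ : (st (L x).length).2.1 = (L x).foldl (step x) (a₀ x) := by simp [st]
  rw [h₁] at hloop
  beta_reduce at h₂
  rw [h₃] at h₂
  refine (hloop.seq h₂).mono ?_
  gcongr
  exact (length_lt_sz _).le

/-- Folding over a list, when each step adds at most a polynomial amount to the accumulator. -/
theorem foldl_of_add {L : α → List ι} {a₀ : α → σ} {step : α → σ → ι → σ} (hL : Poly L)
    (ha : Poly a₀) (hstep : Poly fun p : α × (σ × ι) => step p.1 p.2.1 p.2.2) {M : α → ℕ}
    (hM : PolyBdd M) (hb : ∀ x a, ∀ i ∈ L x, sz (step x a i) ≤ sz a + M x) :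
    Poly fun x => (L x).foldl (step x) (a₀ x) := by
  refine foldl hL ha hstep (ha.polyBdd_sz.add (hL.polyBdd_sz.mul hM)) fun x l₁ l₂ h => ?_
  have h₁ : sz (l₁.foldl (step x) (a₀ x)) ≤ sz (a₀ x) + l₁.length * M x := by
    have hl : ∀ i ∈ l₁, i ∈ L x := fun i hi => by rw [h]; simp [hi]
    clear h
    induction l₁ using List.reverseRecOn with
    | nil => simp
    | append_singleton l i ih =>
      have h₁ := ih fun j hj => hl j (by simp [hj])
      have h₂ := hb x (l.foldl (step x) (a₀ x)) i (hl i (by simp))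
      simp only [List.foldl_append, List.foldl_cons, List.foldl_nil, List.length_append,
        List.length_singleton, add_mul, one_mul]
      omega
  refine h₁.trans (Nat.add_le_add_left (Nat.mul_le_mul_right _ ?_) _)
  have := length_lt_sz (L x)
  rw [h, List.length_append] at this
  rw [h]
  omega

end Poly

/-- Members of a list are smaller than the list, so the bound can be made independent of the member,
as folds require. -/
theorem PolyBdd.exists_of_mem {α ι : Type} [Enc α] [Enc ι] {e : α × ι → ℕ} {L : α → List ι}
    (he : PolyBdd e) (hL : PolyBdd fun x => sz (L x)) :
    ∃ M : α → ℕ, PolyBdd M ∧ ∀ x, ∀ i ∈ L x, e (x, i) ≤ M x := by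
  obtain ⟨C, a, he⟩ := he
  refine ⟨_, (PolyBdd.const C).mul ((((PolyBdd.const 1).add .size).add hL).pow a), fun x i hi => ?_⟩
  refine (he _).trans (Nat.mul_le_mul_left _ (Nat.pow_le_pow_left ?_ _))
  have := sz_le_of_mem hi
  simp only [sz_pair]; omega

namespace Poly

variable {α β γ ι σ : Type} [Enc α] [Enc β] [Enc γ] [Enc ι] [Enc σ]

/-! ### Lists -/

@[fun_prop]
theorem reverse {L : α → List ι} (hL : Poly L) : Poly fun x => (L x).reverse := by
  refine (foldl_of_add (step := fun _ acc i => i :: acc) (a₀ := fun _ => []) hL (by fun_prop)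
    (by fun_prop) ((PolyBdd.const 1).add hL.polyBdd_sz) fun x a i hi => ?_).congr fun x => ?_
  · have := sz_le_of_mem hi
    simp only [sz_list_cons]; omega
  · simp

@[fun_prop]
theorem append {L L' : α → List ι} (hL : Poly L) (hL' : Poly L') :
    Poly fun x => L x ++ L' x := by
  refine (foldl_of_add (step := fun _ acc i => i :: acc) (a₀ := L') hL.reverse (by fun_prop)
    (by fun_prop) ((PolyBdd.const 1).add hL.reverse.polyBdd_sz) fun x a i hi => ?_).congr
    fun x => ?_
  · have := sz_le_of_mem hi
    simp only [sz_list_cons]; omega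
  · simp

@[fun_prop]
theorem flatMap {L : α → List ι} {g : α → ι → List β} (hL : Poly L)
    (hg : Poly fun p : α × ι => g p.1 p.2) : Poly fun x => (L x).flatMap (g x) := by
  obtain ⟨M, hM, hb⟩ := hg.polyBdd_sz.exists_of_mem hL.polyBdd_sz
  refine (foldl_of_add (step := fun x acc i => acc ++ g x i) (a₀ := fun _ => []) hL (by fun_prop)
    ?_ hM fun x a i hi => ?_).congr fun x => ?_
  · exact append (by fun_prop) (hg.comp (f := fun p : α × List β × ι => (p.1, p.2.2))
      (by fun_prop))
  · have := hb x i hi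
    have := sz_append a (g x i)
    dsimp at *; omega
  · simp [List.flatMap_def]

@[fun_prop]
theorem map {L : α → List ι} {g : α → ι → β} (hL : Poly L)
    (hg : Poly fun p : α × ι => g p.1 p.2) : Poly fun x => (L x).map (g x) :=
  (flatMap (g := fun x i => [g x i]) hL (by fun_prop)).congr fun x => List.map_eq_flatMap

@[fun_prop]
theorem filter {L : α → List ι} {c : α → ι → Bool} (hL : Poly L)
    (hc : Poly fun p : α × ι => c p.1 p.2) : Poly fun x => (L x).filter (c x) := by
  refine (flatMap (g := fun x i => bif c x i then [i] else []) hL (by fun_prop)).congr fun x => ?_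
  induction L x with
  | nil => rfl
  | cons i l ih =>
    rw [List.filter_cons, List.flatMap_cons, ih]
    cases c x i <;> simp

@[fun_prop]
theorem isEmpty {L : α → List ι} (hL : Poly L) : Poly fun x => (L x).isEmpty :=
  (listCases (f := fun _ => true) (g := fun _ _ _ => false) hL (by fun_prop) (by fun_prop)).congr
    fun x => by cases L x <;> rfl

@[fun_prop]
theorem headD {L : α → List ι} {d : α → ι} (hL : Poly L) (hd : Poly d) :
    Poly fun x => (L x).headD (d x) :=
  (listCases (g := fun _ i _ => i) hL hd (by fun_prop)).congr
    fun x => by cases L x <;> rfl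

@[fun_prop]
theorem not {c : α → Bool} (hc : Poly c) : Poly fun x => !c x :=
  (cond (f := fun _ => false) (g := fun _ => true) hc (by fun_prop) (by fun_prop)).congr
    fun x => by cases c x <;> rfl

@[fun_prop]
theorem and {c d : α → Bool} (hc : Poly c) (hd : Poly d) : Poly fun x => c x && d x :=
  (cond (f := d) (g := fun _ => false) hc (by fun_prop) (by fun_prop)).congr
    fun x => by cases c x <;> rfl

@[fun_prop]
theorem or {c d : α → Bool} (hc : Poly c) (hd : Poly d) : Poly fun x => c x || d x :=
  (cond (f := fun _ => true) (g := d) hc (by fun_prop) (by fun_prop)).congr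
    fun x => by cases c x <;> rfl

@[fun_prop]
theorem any {L : α → List ι} {c : α → ι → Bool} (hL : Poly L)
    (hc : Poly fun p : α × ι => c p.1 p.2) : Poly fun x => (L x).any (c x) := by
  refine (not (isEmpty (filter hL hc))).congr fun x => ?_
  rw [Bool.eq_iff_iff]
  simp

@[fun_prop]
theorem all {L : α → List ι} {c : α → ι → Bool} (hL : Poly L)
    (hc : Poly fun p : α × ι => c p.1 p.2) : Poly fun x => (L x).all (c x) := by
  refine (isEmpty (filter (c := fun x i => !c x i) hL (by fun_prop))).congr fun x => ?_
  rw [Bool.eq_iff_iff]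
  simp

/-! ### Natural numbers in unary -/

@[fun_prop]
theorem length {L : α → List ι} (hL : Poly L) : Poly fun x => (L x).length := by
  have h : Poly (List.length : List Unit → ℕ) := of_enc_eq fun l => by
    induction l with
    | nil => rfl
    | cons a l ih => rw [List.length_cons, enc_nat_succ, ih]; rfl
  exact (h.comp (map (g := fun _ _ => ()) hL (by fun_prop))).congr fun x => by simp

@[fun_prop]
theorem units {f : α → ℕ} (hf : Poly f) : Poly fun x => List.replicate (f x) () := by
  have h : Poly fun n : ℕ => List.replicate n () := of_enc_eq fun n => by
    induction n with
    | zero => rfl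
    | succ n ih => rw [List.replicate_succ, enc_list_cons, ih]; rfl
  exact h.comp hf

@[fun_prop]
theorem add {f g : α → ℕ} (hf : Poly f) (hg : Poly g) : Poly fun x => f x + g x :=
  (length (hf.units.append hg.units)).congr fun x => by simp

@[fun_prop]
theorem mul {f g : α → ℕ} (hf : Poly f) (hg : Poly g) : Poly fun x => f x * g x :=
  (length (flatMap (g := fun x _ => List.replicate (g x) ()) hf.units (by fun_prop))).congr
    fun x => by simp [List.length_flatMap]

@[fun_prop]
theorem range {f : α → ℕ} (hf : Poly f) : Poly fun x => List.range (f x) := by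
  have key : ∀ l : List Unit, l.foldl (fun acc _ => acc.length :: acc) ([] : List ℕ) =
      (List.range l.length).reverse := fun l => by
    induction l using List.reverseRecOn with
    | nil => rfl
    | append_singleton l a ih => simp [ih, List.range_succ]
  have hs := hf.polyBdd_sz
  refine (reverse (foldl (step := fun _ acc _ => acc.length :: acc)
    (a₀ := fun _ => ([] : List ℕ)) (M := fun x => 1 + sz (f x) * (1 + sz (f x))) hf.units
    (by fun_prop) (by fun_prop) ((PolyBdd.const 1).add (hs.mul ((PolyBdd.const 1).add hs)))
    fun x l₁ l₂ h => ?_)).congr fun x => by simp [key]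
  have hl := congrArg List.length h
  simp only [List.length_replicate, List.length_append] at hl
  rw [key]
  refine (sz_list_le (M := sz (f x)) fun a ha => ?_).trans ?_
  · simp at ha ⊢; omega
  · gcongr
    simp; omega

@[fun_prop]
theorem drop {L : α → List ι} {f : α → ℕ} (hL : Poly L) (hf : Poly f) :
    Poly fun x => (L x).drop (f x) := by
  refine (foldl_of_add (step := fun _ acc _ => acc.tail) (a₀ := L) hf.units (by fun_prop)
    (by fun_prop) (PolyBdd.const 0) fun x a i hi => ?_).congr fun x => ?_
  · cases a <;> simp
  · generalize L x = l
    induction f x generalizing l with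
    | zero => rfl
    | succ n ih => rw [List.replicate_succ, List.foldl_cons, ← ih, List.drop_tail]

@[fun_prop]
theorem getD {L : α → List ι} {f : α → ℕ} {d : α → ι} (hL : Poly L) (hf : Poly f)
    (hd : Poly d) : Poly fun x => (L x).getD (f x) (d x) :=
  ((hL.drop hf).headD hd).congr fun x => by
    rw [List.getD_eq_getElem?_getD, List.headD_eq_head?_getD, List.head?_drop]

@[fun_prop]
theorem sub {f g : α → ℕ} (hf : Poly f) (hg : Poly g) : Poly fun x => f x - g x :=
  (length (hf.units.drop hg)).congr fun x => by simp

@[fun_prop]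
theorem ble {f g : α → ℕ} (hf : Poly f) (hg : Poly g) : Poly fun x => Nat.ble (f x) (g x) :=
  (isEmpty (hf.units.drop hg)).congr fun x => by
    rw [Bool.eq_iff_iff]; simp [Nat.sub_eq_zero_iff_le]

@[fun_prop]
theorem beq {f g : α → ℕ} (hf : Poly f) (hg : Poly g) : Poly fun x => Nat.beq (f x) (g x) :=
  ((hf.ble hg).and (hg.ble hf)).congr fun x => by
    rw [Bool.eq_iff_iff]; simp; omega

theorem _root_.Nat.ble_eq_decide (a b : ℕ) : Nat.ble a b = decide (a ≤ b) := by
  rw [Bool.eq_iff_iff]; simp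

theorem _root_.Nat.beq_eq_decide (a b : ℕ) : Nat.beq a b = decide (a = b) := by
  rw [Bool.eq_iff_iff]; simp

@[fun_prop]
theorem min {f g : α → ℕ} (hf : Poly f) (hg : Poly g) : Poly fun x => min (f x) (g x) :=
  (cond (hf.ble hg) hf hg).congr fun x => by
    cases h : Nat.ble (f x) (g x)
    · have : ¬ f x ≤ g x := by rw [← Nat.ble_eq, h]; simp
      simp; omega
    · have : f x ≤ g x := by rw [← Nat.ble_eq, h]
      simp; omega

end Poly

/-! ## Exhaustive search -/

/-- The mixed radix digits of `m`, least significant digit first. -/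
def digits : List ℕ → ℕ → List ℕ
  | [], _ => []
  | r :: ρ, m => m % r :: digits ρ (m / r)

@[simp] theorem length_digits (ρ : List ℕ) (m : ℕ) : (digits ρ m).length = ρ.length := by
  induction ρ generalizing m with
  | nil => rfl
  | cons r ρ ih => simp [digits, ih]

theorem sz_digits_le {ρ : List ℕ} (m : ℕ) (hρ : ∀ r ∈ ρ, 0 < r) : sz (digits ρ m) ≤ sz ρ := by
  induction ρ generalizing m with
  | nil => rfl
  | cons r ρ ih =>
    have h₁ := ih (m / r) fun q hq => hρ q (List.mem_cons_of_mem _ hq)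
    have h₂ := Nat.mod_lt m (hρ r List.mem_cons_self)
    simp only [digits, sz_list_cons, sz_nat]; omega

theorem exists_digits_eq {ρ v : List ℕ} (h : List.Forall₂ (· < ·) v ρ) :
    ∃ m < ρ.prod, digits ρ m = v := by
  induction h with
  | nil => exact ⟨0, by simp, rfl⟩
  | @cons a r v ρ har _ ih =>
    obtain ⟨m, hm, hd⟩ := ih
    refine ⟨a + r * m, ?_, ?_⟩
    · rw [List.prod_cons]
      calc a + r * m < r + r * m := by omega
        _ = r * (m + 1) := by ring
        _ ≤ r * ρ.prod := Nat.mul_le_mul_left _ hm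
    · simp [digits, Nat.mod_eq_of_lt har, Nat.add_mul_div_left a m (by omega : 0 < r),
        Nat.div_eq_of_lt har, hd]

theorem digits_append_singleton (ρ : List ℕ) (r m : ℕ) :
    digits (ρ ++ [r]) m = digits ρ m ++ [m / ρ.prod % r] := by
  induction ρ generalizing m with
  | nil => simp [digits]
  | cons q ρ ih => simp [digits, ih, Nat.div_div_eq_div_mul]

/-- One step of the addition of one: the state is the carry, the remaining digits and the reversed
list of the new digits. -/
def incStep (s : Bool × (List ℕ × List ℕ)) (r : ℕ) : Bool × (List ℕ × List ℕ) :=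
  bif s.1 && Nat.ble r (s.2.1.headD 0 + 1) then (true, (s.2.1.tail, 0 :: s.2.2))
  else bif s.1 then (false, (s.2.1.tail, (s.2.1.headD 0 + 1) :: s.2.2))
  else (false, (s.2.1.tail, s.2.1.headD 0 :: s.2.2))

theorem foldl_incStep_false (ρ : List ℕ) (m : ℕ) (o : List ℕ) :
    ρ.foldl incStep (false, (digits ρ m, o)) = (false, ([], (digits ρ m).reverse ++ o)) := by
  induction ρ generalizing m o with
  | nil => rfl
  | cons r ρ ih => simp [incStep, digits, ih]

/-- The carry passes a digit of radix `r` exactly when `r` divides `m + 1`. A carry out of the last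
digit therefore signals that all tuples have been visited. -/
theorem foldl_incStep_true (ρ : List ℕ) (hρ : ∀ r ∈ ρ, 0 < r) (m : ℕ) (o : List ℕ) :
    ρ.foldl incStep (true, (digits ρ m, o)) =
      (decide (ρ.prod ∣ m + 1), ([], (digits ρ (m + 1)).reverse ++ o)) := by
  induction ρ generalizing m o with
  | nil => simp [digits]
  | cons r ρ ih =>
    have hr := hρ r List.mem_cons_self
    have hm := Nat.mod_lt m hr
    have hdm := Nat.div_add_mod m r
    by_cases h : r ≤ m % r + 1
    · have e : m + 1 = r * (m / r + 1) := by rw [mul_add]; omega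
      have h₁ : (m + 1) % r = 0 := by rw [e]; simp
      have h₂ : (m + 1) / r = m / r + 1 := by rw [e]; simp [hr]
      have h₃ : r * ρ.prod ∣ m + 1 ↔ ρ.prod ∣ m / r + 1 := by
        rw [e]; exact Nat.mul_dvd_mul_iff_left hr
      simp [incStep, digits, Nat.ble_eq_decide, h, ih fun q hq => hρ q (List.mem_cons_of_mem _ hq), h₁, h₂, h₃]
    · have e : m + 1 = (m % r + 1) + r * (m / r) := by omega
      have h₁ : (m + 1) % r = m % r + 1 := by
        rw [e, Nat.add_mul_mod_self_left, Nat.mod_eq_of_lt (by omega)]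
      have h₂ : (m + 1) / r = m / r := by
        rw [e, Nat.add_mul_div_left _ _ hr, Nat.div_eq_of_lt (by omega), zero_add]
      have h₃ : ¬ r * ρ.prod ∣ m + 1 := fun hd => by
        have := Nat.mod_eq_zero_of_dvd ((Dvd.intro _ rfl).trans hd)
        omega
      simp [incStep, digits, Nat.ble_eq_decide, h, foldl_incStep_false, h₁, h₂, h₃]

theorem sz_incStep_le (s : Bool × (List ℕ × List ℕ)) (r : ℕ) : sz (incStep s r) ≤ sz s + 10 := by
  obtain ⟨b, v, o⟩ := s
  have h₁ : 1 ≤ sz b := sz_pos b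
  have h₂ : sz true = 3 := rfl
  have h₃ : sz false = 1 := rfl
  have h₅ : sz v.tail + 2 * v.headD 0 ≤ sz v := by cases v <;> simp; omega
  unfold incStep
  simp only [cond_eq_ite]
  split_ifs <;> simp only [sz_pair, sz_list_cons, sz_nat] <;> omega

theorem Poly.foldl_incStep {α : Type} [Enc α] {v ρ : α → List ℕ} (hv : Poly v) (hρ : Poly ρ) :
    Poly fun x => (ρ x).foldl incStep (true, (v x, [])) := by
  refine Poly.foldl_of_add (step := fun _ => incStep) hρ (by fun_prop) ?_ (PolyBdd.const 10)
    fun x a i _ => sz_incStep_le a i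
  unfold incStep
  fun_prop

/-- A flag that says whether the search goes on, its input, the digits to be tried next, and the
result. -/
abbrev SearchState (α : Type) : Type := Bool × ((α × List ℕ) × (List ℕ × List (List ℕ)))

/-- For a polynomial time predicate on lists of digits, a program searches the first list of digits
that satisfies it. -/
theorem exists_search {α : Type} [Enc α] {pred : α → List ℕ → Bool}
    (hp : Poly fun p : α × List ℕ => pred p.1 p.2) :
    ∃ (P : ℕ → Prog) (b : α × List ℕ → ℕ), PolyBdd b ∧ ∀ x ρ, (∀ r ∈ ρ, 0 < r) →
      (∃ m < ρ.prod, pred x (digits ρ m) = true ∧ (∀ i < m, pred x (digits ρ i) = false) ∧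
        Maps P (enc (x, ρ)) (enc [digits ρ m]) (ρ.prod * b (x, ρ))) ∨
      ((∀ i < ρ.prod, pred x (digits ρ i) = false) ∧
        Maps P (enc (x, ρ)) (enc ([] : List (List ℕ))) (ρ.prod * b (x, ρ))) := by
  let next : α × List ℕ → List ℕ → SearchState α := fun p v =>
    let q := p.2.foldl incStep (true, (v, []))
    (!q.1, (p, (q.2.2.reverse, [])))
  let step : SearchState α → SearchState α := fun s =>
    bif pred s.2.1.1 s.2.2.1 then (false, (s.2.1, (s.2.2.1, [s.2.2.1]))) else next s.2.1 s.2.2.1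
  have hstep : Poly step := by
    have h₁ : Poly fun s : SearchState α => s.2.1.2.foldl incStep (true, (s.2.2.1, [])) :=
      Poly.foldl_incStep (by fun_prop) (by fun_prop)
    have h₂ : Poly fun s : SearchState α => pred s.2.1.1 s.2.2.1 :=
      hp.comp (f := fun s : SearchState α => (s.2.1.1, s.2.2.1)) (by fun_prop)
    refine h₂.cond (by fun_prop) (h₁.fst'.not.prodMk (Poly.prodMk (by fun_prop) ?_))
    exact h₁.snd'.snd'.reverse.prodMk (by fun_prop)
  have hinit : Poly fun p : α × List ℕ => (true, (p, (p.2.map fun _ => 0, ([] : List (List ℕ))))) := by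
    fun_prop
  have hfin : Poly fun s : SearchState α => s.2.2.2 := by fun_prop
  obtain ⟨P₀, τ₀, hτ₀, hs₀, hP₀⟩ := hinit
  obtain ⟨P₁, τ₁, ⟨C, a, hτ₁⟩, -, hP₁⟩ := hstep
  obtain ⟨P₂, τ₂, ⟨C', a', hτ₂⟩, -, hP₂⟩ := hfin
  -- A search state contains the input, the current tuple and at most one copy of it as the result;
  -- a tuple is no larger than the list of radices. Hence the cost of one round does not depend on
  -- the number of tuples.
  let B : α × List ℕ → ℕ := fun p => 10 + 3 * sz p
  have hB : PolyBdd B := (PolyBdd.const 10).add ((PolyBdd.const 3).mul .size)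
  refine ⟨Maps.seqProg P₀ (Maps.seqProg (Maps.whileProg P₁) P₂), _,
    hτ₀.add (((((PolyBdd.const C).mul (hB.pow a)).add (.const 3)).add (.const 3)).add
      ((PolyBdd.const C').mul (hB.pow a'))), fun x ρ hρ => ?_⟩
  have hprod : 0 < ρ.prod := List.prod_pos hρ
  let st : ℕ → SearchState α := fun i => (true, ((x, ρ), (digits ρ i, [])))
  -- `T` is the number of rounds: `m + 1` if the first success is at `m`, and `ρ.prod` if there is
  -- none. Only the last round clears the flag, so success and failure differ merely in the final
  -- state.
  have key : ∀ T ≤ ρ.prod, 0 < T → (∀ i, i + 1 < T → pred x (digits ρ i) = false) → ∀ fin : SearchState α,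
      fin.1 = false → step (st (T - 1)) = fin → sz fin ≤ B (x, ρ) →
      Maps (Maps.seqProg P₀ (Maps.seqProg (Maps.whileProg P₁) P₂)) (enc (x, ρ)) (enc fin.2.2.2)
        (ρ.prod * (τ₀ (x, ρ) + (C * B (x, ρ) ^ a + 3 + 3 + C' * B (x, ρ) ^ a'))) := by
    intro T hT hT₀ hn fin hfin hfin' hszf
    have hsz : ∀ i, sz (st i) ≤ B (x, ρ) := fun i => by
      have h₁ := sz_digits_le i hρ
      have h₂ : sz true = 3 := rfl
      simp only [st, B, sz_pair, sz_list_nil]; omega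
    have h₀ : st 0 = (true, ((x, ρ), (ρ.map fun _ => 0, []))) := by
      have : ∀ ρ : List ℕ, digits ρ 0 = ρ.map fun _ => 0 := fun ρ => by
        induction ρ with
        | nil => rfl
        | cons r ρ ih => simp [digits, ih]
      simp [st, this]
    have hm₀ : Maps P₀ (enc (x, ρ)) (enc (st 0)) (τ₀ (x, ρ)) := by
      rw [h₀]; exact hP₀ (x, ρ)
    have hloop := Maps.while_loop (P := P₁) (u := C * B (x, ρ) ^ a) T
      (fun i => enc (if i < T then st i else fin)) (fun i hi => ?_) (fun i hi => ?_) ?_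
    · simp only [hT₀, lt_irrefl, if_true, if_false] at hloop
      have h₂ := (hP₂ fin).mono ((hτ₂ _).trans
        (Nat.mul_le_mul_left _ (Nat.pow_le_pow_left hszf _)))
      refine (hm₀.seq (hloop.seq h₂)).mono ?_
      have e : ρ.prod * (τ₀ (x, ρ) + (C * B (x, ρ) ^ a + 3 + 3 + C' * B (x, ρ) ^ a')) =
        ρ.prod * τ₀ (x, ρ) + (ρ.prod * (C * B (x, ρ) ^ a + 3) + ρ.prod * 3 +
          ρ.prod * (C' * B (x, ρ) ^ a')) := by ring
      rw [e]
      exact add_le_add (Nat.le_mul_of_pos_left _ hprod) (add_le_add (add_le_add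
        (Nat.mul_le_mul_right _ hT) (by omega)) (Nat.le_mul_of_pos_left _ hprod))
    · have hs : step (if i < T then st i else fin) = if i + 1 < T then st (i + 1) else fin := by
        rw [if_pos hi]
        split_ifs with h
        · have hd : ¬ ρ.prod ∣ i + 1 := fun hd => by
            have := Nat.le_of_dvd (by omega) hd; omega
          simp [step, st, hn i h, next, foldl_incStep_true ρ hρ, hd]
        · rw [← hfin']; congr 2; omega
      rw [← hs]
      refine (hP₁ _).mono ((hτ₁ _).trans (Nat.mul_le_mul_left _ (Nat.pow_le_pow_left ?_ _)))
      rw [if_pos hi]; exact hsz i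
    · simp [hi, st, enc_pair, enc_true, Data.hd]
    · obtain ⟨b, fin⟩ := fin
      subst hfin
      simp [enc_pair, enc_false, Data.hd]
  have hf : sz false = 1 := rfl
  have hszd : ∀ i, sz (digits ρ i) ≤ sz ρ := fun i => sz_digits_le i hρ
  by_cases h : ∃ m < ρ.prod, pred x (digits ρ m) = true
  · classical
    obtain ⟨hm, hpm⟩ := Nat.find_spec h
    have hlt : ∀ i < Nat.find h, pred x (digits ρ i) = false := fun i hi => by
      have := Nat.find_min h hi
      simpa [hi.trans hm] using this
    generalize Nat.find h = m at hm hpm hlt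
    refine Or.inl ⟨m, hm, hpm, hlt, key (m + 1) hm (by omega) (fun i hi => hlt i (by omega))
      (false, ((x, ρ), (digits ρ m, [digits ρ m]))) rfl (by simp [step, st, hpm]) ?_⟩
    have := hszd m
    simp only [B, sz_pair, sz_list_cons, sz_list_nil]; omega
  · push Not at h
    simp only [Bool.not_eq_true] at h
    refine Or.inr ⟨h, key ρ.prod le_rfl hprod (fun i hi => h i (by omega))
      (false, ((x, ρ), (digits ρ ρ.prod, []))) rfl ?_ ?_⟩
    · simp [step, st, h (ρ.prod - 1) (by omega), next, foldl_incStep_true ρ hρ,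
        Nat.sub_add_cancel hprod]
    · have := hszd ρ.prod
      simp only [B, sz_pair, sz_list_nil]; omega

end WhileLang

namespace BudgetedColoring

open WhileLang

/-! ## Bipartite matching by an auction -/

/-- The right vertices of the bipartite graphs. -/
abbrev Slot : Type := ℕ × ℕ

/-- The left vertices of the bipartite graphs: a label and the list of the neighbors. -/
abbrev Bidder : Type := (ℕ × ℕ) × List Slot

def slotEq (r r' : Slot) : Bool := Nat.beq r.1 r'.1 && Nat.beq r.2 r'.2

theorem slotEq_eq_decide (r r' : Slot) : slotEq r r' = decide (r = r') := by
  rw [Bool.eq_iff_iff]; simp [slotEq, Prod.ext_iff]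

/-- The number of bids for a slot. -/
def price (log : List (Bidder × Slot)) (r : Slot) : ℕ :=
  (log.filter fun e => slotEq e.2 r).length

/-- The last bidder for a slot, if there is one. -/
def owner (log : List (Bidder × Slot)) (r : Slot) : List Bidder :=
  listCases (log.filter fun e => slotEq e.2 r) [] fun e _ => [e.1]

def cheapest (log : List (Bidder × Slot)) (N : List Slot) : List Slot :=
  N.filter fun r => N.all fun r' => Nat.ble (price log r) (price log r')

/-- The first bidder of the queue bids for a cheapest slot and replaces its owner. -/
def auctionStep (s : List Bidder × List (Bidder × Slot)) : List Bidder × List (Bidder × Slot) :=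
  listCases s.1 s fun v q =>
    listCases (cheapest s.2 v.2) s fun r _ => (owner s.2 r ++ q, (v, r) :: s.2)

def auctionRun (L : List Bidder) (fuel : ℕ) : List Bidder × List (Bidder × Slot) :=
  (List.replicate fuel ()).foldl (fun s _ => auctionStep s) (L, [])

def auction (L : List Bidder) (fuel : ℕ) : Bool := (auctionRun L fuel).1.isEmpty

theorem price_cons (log : List (Bidder × Slot)) (v : Bidder) (r r' : Slot) :
    price ((v, r) :: log) r' = price log r' + if r = r' then 1 else 0 := by
  by_cases h : r = r' <;> simp [price, slotEq_eq_decide, h]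

theorem owner_cons (log : List (Bidder × Slot)) (v : Bidder) (r r' : Slot) :
    owner ((v, r) :: log) r' = if r = r' then [v] else owner log r' := by
  by_cases h : r = r' <;> simp [owner, slotEq_eq_decide, h]

theorem owner_eq_nil_iff (log : List (Bidder × Slot)) (r : Slot) :
    owner log r = [] ↔ price log r = 0 := by
  unfold owner price
  cases log.filter fun e => slotEq e.2 r <;> simp

theorem exists_owner_of_price_pos {log : List (Bidder × Slot)} {r : Slot} (h : 0 < price log r) :
    ∃ v, owner log r = [v] := by
  unfold owner
  unfold price at h
  cases h' : log.filter fun e => slotEq e.2 r with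
  | nil => simp [h'] at h
  | cons e l => exact ⟨e.1, by simp⟩

theorem mem_cheapest {log : List (Bidder × Slot)} {N : List Slot} {r : Slot} :
    r ∈ cheapest log N ↔ r ∈ N ∧ ∀ r' ∈ N, price log r ≤ price log r' := by
  simp [cheapest]

theorem cheapest_ne_nil {log : List (Bidder × Slot)} {N : List Slot} (h : N ≠ []) :
    cheapest log N ≠ [] := by
  obtain ⟨r, hr, hmin⟩ := N.toFinset.exists_min_image (price log) (by simpa using h)
  exact List.ne_nil_of_mem (mem_cheapest.2 ⟨by simpa using hr, by simpa using hmin⟩)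

theorem auctionRun_succ (L : List Bidder) (i : ℕ) :
    auctionRun L (i + 1) = auctionStep (auctionRun L i) := by
  simp [auctionRun, List.replicate_succ']

theorem auctionStep_cases (s : List Bidder × List (Bidder × Slot)) :
    (auctionStep s = s ∧ ∀ v ∈ s.1, s.1.head? = some v → v.2 = []) ∨
    ∃ v q r, s.1 = v :: q ∧ r ∈ v.2 ∧ (∀ r' ∈ v.2, price s.2 r ≤ price s.2 r') ∧
      auctionStep s = (owner s.2 r ++ q, (v, r) :: s.2) := by
  obtain ⟨_ | ⟨v, q⟩, log⟩ := s
  · exact Or.inl ⟨rfl, by simp⟩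
  · cases h : cheapest log v.2 with
    | nil =>
      refine Or.inl ⟨by simp [auctionStep, h], ?_⟩
      rintro w - hw
      simp only [List.head?_cons, Option.some.injEq] at hw
      subst hw
      by_contra hv
      exact cheapest_ne_nil hv h
    | cons r l =>
      have hr : r ∈ cheapest log v.2 := by simp [h]
      rw [mem_cheapest] at hr
      exact Or.inr ⟨v, q, r, rfl, hr.1, hr.2, by simp [auctionStep, h]⟩

/-- The invariant of the auction. -/
structure AuctionInv (L q : List Bidder) (log : List (Bidder × Slot)) : Prop where
  nodup : q.Nodup
  sub : ∀ v ∈ q, v ∈ L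
  own_mem : ∀ r v, owner log r = [v] → v ∈ L ∧ v ∉ q ∧ r ∈ v.2
  slack : ∀ r v, owner log r = [v] → ∀ r' ∈ v.2, price log r ≤ price log r' + 1
  inj : ∀ r r' v, owner log r = [v] → owner log r' = [v] → r = r'
  cover : ∀ v ∈ L, v ∈ q ∨ ∃ r, owner log r = [v]

/-- A higher price at `r` only relaxes `slack` for the other owners. The new owner chose a cheapest
slot, which after its bid exceeds the alternatives by at most one. The displaced owner returns to
the queue, which preserves `cover`. -/
theorem AuctionInv.step {L q : List Bidder} {log : List (Bidder × Slot)} {v : Bidder} {r : Slot}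
    (h : AuctionInv L (v :: q) log) (hr : r ∈ v.2) (hmin : ∀ r' ∈ v.2, price log r ≤ price log r') :
    AuctionInv L (owner log r ++ q) ((v, r) :: log) := by
  have hvq : v ∉ q := (List.nodup_cons.1 h.nodup).1
  have hq : q.Nodup := (List.nodup_cons.1 h.nodup).2
  have hown : ∀ w, w ∈ owner log r ↔ owner log r = [w] := fun w => by
    by_cases h₀ : 0 < price log r
    · obtain ⟨u, hu⟩ := exists_owner_of_price_pos h₀
      simp [hu, eq_comm]
    · have := (owner_eq_nil_iff log r).2 (by omega)
      simp [this]
  refine ⟨?_, ?_, ?_, ?_, ?_, ?_⟩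
  · rw [List.nodup_append]
    refine ⟨?_, hq, ?_⟩
    · by_cases h₀ : 0 < price log r
      · obtain ⟨u, hu⟩ := exists_owner_of_price_pos h₀
        simp [hu]
      · simp [(owner_eq_nil_iff log r).2 (by omega)]
    · rintro w hw u hu rfl
      exact (h.own_mem r w ((hown w).1 hw)).2.1 (List.mem_cons_of_mem _ hu)
  · intro w hw
    rcases List.mem_append.1 hw with hw | hw
    · exact (h.own_mem r w ((hown w).1 hw)).1
    · exact h.sub w (List.mem_cons_of_mem _ hw)
  · intro r' w hw
    rw [owner_cons] at hw
    split_ifs at hw with e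
    · obtain rfl : v = w := by simpa using hw
      subst e
      refine ⟨h.sub v List.mem_cons_self, fun hv => ?_, hr⟩
      rcases List.mem_append.1 hv with hv | hv
      · exact (h.own_mem _ _ ((hown v).1 hv)).2.1 List.mem_cons_self
      · exact hvq hv
    · obtain ⟨h₁, h₂, h₃⟩ := h.own_mem r' w hw
      refine ⟨h₁, fun hv => ?_, h₃⟩
      rcases List.mem_append.1 hv with hv | hv
      · exact e (h.inj _ _ _ ((hown w).1 hv) hw)
      · exact h₂ (List.mem_cons_of_mem _ hv)
  · intro r' w hw r'' hr''
    rw [owner_cons] at hw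
    simp only [price_cons]
    split_ifs at hw with e
    · obtain rfl : v = w := by simpa using hw
      have := hmin r'' hr''
      subst e
      simp only [if_true]; omega
    · have := h.slack r' w hw r'' hr''
      simp only [e, if_false]; omega
  · intro r₁ r₂ w h₁ h₂
    rw [owner_cons] at h₁ h₂
    split_ifs at h₁ h₂ with e₁ e₂ e₂
    · exact e₁.symm.trans e₂
    · obtain rfl : v = w := by simpa using h₁
      exact absurd List.mem_cons_self (h.own_mem _ _ h₂).2.1
    · obtain rfl : v = w := by simpa using h₂
      exact absurd List.mem_cons_self (h.own_mem _ _ h₁).2.1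
    · exact h.inj _ _ _ h₁ h₂
  · intro w hw
    by_cases hwv : w = v
    · exact Or.inr ⟨r, by simp [owner_cons, hwv]⟩
    · rcases h.cover w hw with hw | ⟨r', hr'⟩
      · exact Or.inl (List.mem_append_right _ ((List.mem_cons.1 hw).resolve_left hwv))
      · by_cases e : r = r'
        · subst e
          exact Or.inl (List.mem_append_left _ ((hown w).2 hr'))
        · exact Or.inr ⟨r', by simp [owner_cons, e, hr']⟩

theorem auctionInv_run {L : List Bidder} (hL : L.Nodup) (i : ℕ) :
    AuctionInv L (auctionRun L i).1 (auctionRun L i).2 := by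
  induction i with
  | zero =>
    refine ⟨hL, fun v hv => hv, ?_, ?_, ?_, fun v hv => Or.inl hv⟩ <;>
      simp [auctionRun, owner]
  | succ i ih =>
    rw [auctionRun_succ]
    rcases auctionStep_cases (auctionRun L i) with ⟨h, -⟩ | ⟨v, q, r, hq, hr, hmin, h⟩
    · rwa [h]
    · rw [h]
      rw [hq] at ih
      exact ih.step hr hmin

/-- If there is a matching of all bidders, then the prices that are met are at most the number of
the slots. -/
theorem AuctionInv.price_le {L q : List Bidder} {log : List (Bidder × Slot)} {v : Bidder} {m : ℕ}
    (h : AuctionInv L q log) (hv : v ∈ q) (hm : ∀ r ∈ v.2, m ≤ price log r) {R : Finset Slot}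
    (hR : ∀ v ∈ L, ∀ r ∈ v.2, r ∈ R) {g : Bidder → Slot} (hg : Set.InjOn g {v | v ∈ L})
    (hgL : ∀ v ∈ L, g v ∈ v.2) : m ≤ R.card := by
  classical
  -- If no price equals `j`, let `A` be the slots of price at least `j`. Their owners hold slots of
  -- price at least `j + 1`, so by `slack` all slots they accept lie in `A`; the same holds for the
  -- unserved `v`. Then `g` would inject `A.card + 1` bidders into `A`.
  have level : ∀ j, 1 ≤ j → j ≤ m → ∃ r ∈ R, price log r = j := by
    intro j hj hjm
    by_contra hno
    push Not at hno
    let A := R.filter fun r => j ≤ price log r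
    have hown : ∀ r : A, ∃ w, owner log r = [w] := fun r =>
      exists_owner_of_price_pos (hj.trans (Finset.mem_filter.1 r.2).2)
    choose own hown using hown
    let X : Finset Bidder := insert v (Finset.univ.image own)
    have hX : X.card = A.card + 1 := by
      rw [Finset.card_insert_of_notMem, Finset.card_image_of_injective, Finset.card_univ,
        Fintype.card_coe]
      · intro r r' e
        exact Subtype.ext (h.inj _ _ _ (hown r) (e ▸ hown r'))
      · intro hmem
        obtain ⟨r, -, hr⟩ := Finset.mem_image.1 hmem
        exact (h.own_mem _ _ (hown r)).2.1 (hr ▸ hv)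
    have hXL : ∀ w ∈ X, w ∈ L ∧ g w ∈ A := by
      intro w hw
      rcases Finset.mem_insert.1 hw with rfl | hw
      · have hL := h.sub w hv
        exact ⟨hL, Finset.mem_filter.2 ⟨hR w hL _ (hgL w hL), hjm.trans (hm _ (hgL w hL))⟩⟩
      · obtain ⟨r, -, rfl⟩ := Finset.mem_image.1 hw
        have hL := (h.own_mem _ _ (hown r)).1
        have hgR := hR _ hL _ (hgL _ hL)
        refine ⟨hL, Finset.mem_filter.2 ⟨hgR, ?_⟩⟩
        have h₁ := h.slack _ _ (hown r) _ (hgL _ hL)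
        have h₂ := (Finset.mem_filter.1 r.2).2
        have h₃ := hno _ (Finset.mem_filter.1 r.2).1
        have h₄ := hno _ hgR
        omega
    have := Finset.card_le_card_of_injOn g (fun w hw => (hXL w hw).2)
      (fun w hw w' hw' e => hg (hXL w hw).1 (hXL w' hw').1 e)
    omega
  have : (Finset.Icc 1 m).card ≤ R.card := by
    refine (Finset.card_le_card fun j hj => ?_).trans (Finset.card_image_le (f := price log))
    obtain ⟨r, hr, e⟩ := level j (Finset.mem_Icc.1 hj).1 (Finset.mem_Icc.1 hj).2
    exact Finset.mem_image.2 ⟨r, hr, e⟩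
  simpa using this

/-- Each bid raises exactly one price by one, so a bound on the prices bounds the number of rounds.
-/
theorem length_eq_sum_price {log : List (Bidder × Slot)} {R : Finset Slot}
    (h : ∀ e ∈ log, e.2 ∈ R) : log.length = ∑ r ∈ R, price log r := by
  induction log with
  | nil => simp [price]
  | cons e log ih =>
    obtain ⟨v, r⟩ := e
    simp only [price_cons, Finset.sum_add_distrib, List.length_cons]
    rw [ih fun e he => h e (List.mem_cons_of_mem _ he), Finset.sum_ite_eq,
      if_pos (h (v, r) List.mem_cons_self)]

/-- When the queue is empty, ownership is the matching. Conversely, if a matching exists, the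
auction cannot get stuck and every bid is made at price at most `R.card`. So no price exceeds
`R.card + 1`, and there are at most `R.card * (R.card + 1)` bids. -/
theorem auction_eq_true_iff {L : List Bidder} (hL : L.Nodup) {R : Finset Slot}
    (hR : ∀ v ∈ L, ∀ r ∈ v.2, r ∈ R) {fuel : ℕ} (hf : R.card * (R.card + 1) < fuel) :
    auction L fuel = true ↔
      ∃ g : Bidder → Slot, Set.InjOn g {v | v ∈ L} ∧ ∀ v ∈ L, g v ∈ v.2 := by
  constructor
  · intro h
    have inv := auctionInv_run hL fuel
    rw [auction, List.isEmpty_iff] at h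
    rw [h] at inv
    have := fun v (hv : v ∈ L) => (inv.cover v hv).resolve_left (by simp)
    choose! g hg using this
    refine ⟨g, fun v hv w hw e => ?_, fun v hv => (inv.own_mem _ _ (hg v hv)).2.2⟩
    have h₁ := hg v hv
    rw [e, hg w hw] at h₁
    simpa using h₁.symm
  · rintro ⟨g, hg, hgL⟩
    have key : ∀ i, (auctionRun L i).1 = [] ∨ ((auctionRun L i).2.length = i ∧
        (∀ e ∈ (auctionRun L i).2, e.2 ∈ R) ∧ ∀ r, price (auctionRun L i).2 r ≤ R.card + 1) := by
      intro i
      induction i with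
      | zero => exact Or.inr ⟨rfl, by simp [auctionRun], by simp [auctionRun, price]⟩
      | succ i ih =>
        have inv := auctionInv_run hL i
        rw [auctionRun_succ]
        rcases auctionStep_cases (auctionRun L i) with ⟨h, h'⟩ | ⟨v, q, r, hq, hr, hmin, h⟩
        · rw [h]
          left
          cases hq : (auctionRun L i).1 with
          | nil => rfl
          | cons v q =>
            rw [hq] at inv h'
            have hv := h' v List.mem_cons_self rfl
            have := hgL v (inv.sub v List.mem_cons_self)
            simp [hv] at this
        · rw [h]
          rcases ih with ih | ⟨ih₁, ih₂, ih₃⟩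
          · simp [hq] at ih
          · rw [hq] at inv
            refine Or.inr ⟨by simp [ih₁], ?_, fun r' => ?_⟩
            · intro e he
              rcases List.mem_cons.1 he with rfl | he
              · exact hR v (inv.sub v List.mem_cons_self) r hr
              · exact ih₂ e he
            · dsimp only
              rw [price_cons]
              split_ifs with e
              · subst e
                have := inv.price_le List.mem_cons_self hmin hR hg hgL
                omega
              · exact ih₃ r'
    rw [auction, List.isEmpty_iff]
    refine (key fuel).resolve_right ?_
    rintro ⟨h₁, h₂, h₃⟩
    have : (auctionRun L fuel).2.length ≤ R.card * (R.card + 1) := by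
      rw [length_eq_sum_price h₂]
      exact Finset.sum_le_card_nsmul _ _ _ fun r _ => h₃ r
    omega

/-! ### The auction in polynomial time -/

section

variable {α : Type} [Enc α]

@[fun_prop]
theorem poly_slotEq {f g : α → Slot} (hf : Poly f) (hg : Poly g) :
    Poly fun x => slotEq (f x) (g x) := by
  unfold slotEq; fun_prop

@[fun_prop]
theorem poly_price {f : α → List (Bidder × Slot)} {g : α → Slot} (hf : Poly f) (hg : Poly g) :
    Poly fun x => price (f x) (g x) := by
  unfold price; fun_prop

@[fun_prop]
theorem poly_owner {f : α → List (Bidder × Slot)} {g : α → Slot} (hf : Poly f) (hg : Poly g) :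
    Poly fun x => owner (f x) (g x) := by
  unfold owner; fun_prop

@[fun_prop]
theorem poly_cheapest {f : α → List (Bidder × Slot)} {g : α → List Slot} (hf : Poly f)
    (hg : Poly g) : Poly fun x => cheapest (f x) (g x) := by
  unfold cheapest; fun_prop

theorem poly_auctionStep : Poly auctionStep := by
  unfold auctionStep; fun_prop

/-- These bounds keep the accumulator of the fold polynomial: the queue never grows, since a bid
removes one bidder and returns at most one, and the log grows by at most one entry per round. -/
theorem auctionRun_bounds (L : List Bidder) (i : ℕ) :
    ((∀ v ∈ (auctionRun L i).1, v ∈ L) ∧ ∀ e ∈ (auctionRun L i).2, e.1 ∈ L ∧ e.2 ∈ e.1.2) ∧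
      (auctionRun L i).1.length ≤ L.length ∧ (auctionRun L i).2.length ≤ i := by
  induction i with
  | zero => simp [auctionRun]
  | succ i ih =>
    obtain ⟨⟨h₁, h₂⟩, h₃, h₄⟩ := ih
    rw [auctionRun_succ]
    rcases auctionStep_cases (auctionRun L i) with ⟨h, -⟩ | ⟨v, q, r, hq, hr, -, h⟩
    · rw [h]
      exact ⟨⟨h₁, h₂⟩, h₃, by omega⟩
    · rw [h]
      rw [hq] at h₁ h₃
      have hown : (∀ w ∈ owner (auctionRun L i).2 r, w ∈ L) ∧
          (owner (auctionRun L i).2 r).length ≤ 1 := by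
        unfold owner
        cases hl : (auctionRun L i).2.filter fun e => slotEq e.2 r with
        | nil => simp
        | cons e l =>
          have he : e ∈ (auctionRun L i).2.filter fun e => slotEq e.2 r := by simp [hl]
          simpa using (h₂ e (List.mem_of_mem_filter he)).1
      refine ⟨⟨fun w hw => ?_, fun e he => ?_⟩, ?_, by simpa using h₄⟩
      · rcases List.mem_append.1 hw with hw | hw
        · exact hown.1 w hw
        · exact h₁ w (List.mem_cons_of_mem _ hw)
      · rcases List.mem_cons.1 he with rfl | he
        · exact ⟨h₁ v List.mem_cons_self, hr⟩
        · exact h₂ e he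
      · simp only [List.length_append, List.length_cons] at h₃ ⊢
        have := hown.2
        omega

@[fun_prop]
theorem poly_auction {f : α → List Bidder} {g : α → ℕ} (hf : Poly f) (hg : Poly g) :
    Poly fun x => auction (f x) (g x) := by
  have h₁ := hf.polyBdd_sz
  have h₂ := hg.polyBdd_sz
  refine Poly.isEmpty (Poly.fst' (Poly.foldl (step := fun _ s _ => auctionStep s)
    (a₀ := fun x => (f x, [])) hg.units (by fun_prop)
    (poly_auctionStep.comp (f := fun p : α × ((List Bidder × List (Bidder × Slot)) × Unit) => p.2.1)
      (by fun_prop))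
    (M := fun x => 1 + (1 + sz (f x) * (1 + sz (f x))) +
      (1 + sz (g x) * (1 + (1 + sz (f x) + sz (f x)))))
    (((PolyBdd.const 1).add ((PolyBdd.const 1).add (h₁.mul ((PolyBdd.const 1).add h₁)))).add
      ((PolyBdd.const 1).add (h₂.mul ((PolyBdd.const 1).add
        (((PolyBdd.const 1).add h₁).add h₁)))))
    fun x l₁ l₂ h => ?_))
  have hl := congrArg List.length h
  simp only [List.length_replicate, List.length_append] at hl
  have e : l₁.foldl (fun s _ => auctionStep s) (f x, []) = auctionRun (f x) l₁.length := by
    rw [auctionRun]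
    congr 1
    exact List.eq_replicate_iff.2 ⟨rfl, fun _ _ => rfl⟩
  rw [e]
  obtain ⟨⟨b₁, b₂⟩, b₃, b₄⟩ := auctionRun_bounds (f x) l₁.length
  rw [sz_prod]
  have hlen := length_lt_sz (f x)
  gcongr
  · refine (sz_list_le fun v hv => (sz_le_of_mem (b₁ v hv)).le).trans ?_
    gcongr
    omega
  · refine (sz_list_le (M := 1 + sz (f x) + sz (f x)) fun v hv => ?_).trans ?_
    · have i₁ := sz_le_of_mem (b₂ v hv).1
      have i₂ := sz_le_of_mem (b₂ v hv).2
      have i₃ := sz_snd_le v.1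
      rw [sz_prod]
      omega
    · gcongr
      rw [sz_nat]; omega

end

/-! ## Clusters -/

/-- The vertices below `n` outside `X`. -/
def free (n : ℕ) (X : List ℕ) : List ℕ :=
  (List.range n).filter fun v => !X.any fun x => Nat.beq v x

/-- The induced paths on three vertices outside `X`. -/
def paths (E : ℕ → ℕ → Bool) (n : ℕ) (X : List ℕ) : List (ℕ × (ℕ × ℕ)) :=
  (free n X).flatMap fun u => (free n X).flatMap fun v =>
    ((free n X).filter fun w => E u v && (E v w && (!Nat.beq u w && !E u w))).map fun w =>
      (u, (v, w))

/-- The least vertex of the cluster of `v`. -/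
def rep (E : ℕ → ℕ → Bool) (n : ℕ) (X : List ℕ) (v : ℕ) : ℕ :=
  ((free n X).filter fun u => Nat.beq u v || E u v).headD v

/-- The least vertices of the clusters. -/
def reps (E : ℕ → ℕ → Bool) (n : ℕ) (X : List ℕ) : List ℕ :=
  (free n X).filter fun v => Nat.beq (rep E n X v) v

theorem mem_free {n : ℕ} {X : List ℕ} {v : ℕ} : v ∈ free n X ↔ v < n ∧ v ∉ X := by
  simp only [free, List.mem_filter, List.mem_range, Bool.not_eq_true', List.any_eq_false,
    Nat.beq_eq]
  exact and_congr_right fun _ => ⟨fun h hv => h v hv rfl, fun h x hx e => h (e ▸ hx)⟩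

theorem sortedLT_free (n : ℕ) (X : List ℕ) : (free n X).Pairwise (· < ·) :=
  List.Pairwise.filter _ List.pairwise_lt_range

theorem nodup_free (n : ℕ) (X : List ℕ) : (free n X).Nodup :=
  (sortedLT_free n X).imp fun h => h.ne

theorem nodup_reps (E : ℕ → ℕ → Bool) (n : ℕ) (X : List ℕ) : (reps E n X).Nodup :=
  (nodup_free n X).filter _

/-- The graph with the adjacency relation `E` on the vertices below `n` is a graph. -/
structure IsGraph (E : ℕ → ℕ → Bool) : Prop where
  symm : ∀ u v, E u v = true → E v u = true
  irrefl : ∀ v, E v v = false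

theorem mem_paths {E : ℕ → ℕ → Bool} {n : ℕ} {X : List ℕ} {u v w : ℕ} :
    (u, (v, w)) ∈ paths E n X ↔ (u ∈ free n X ∧ v ∈ free n X ∧ w ∈ free n X) ∧
      E u v = true ∧ E v w = true ∧ u ≠ w ∧ E u w = false := by
  simp only [paths, List.mem_flatMap, List.mem_map, List.mem_filter, Nat.beq_eq_decide,
    Bool.and_eq_true, Bool.not_eq_true', decide_eq_false_iff_not, Prod.mk.injEq]
  aesop

/-- The vertices outside `X` form a cluster graph. -/
def IsCluster (E : ℕ → ℕ → Bool) (n : ℕ) (X : List ℕ) : Prop :=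
  ∀ u ∈ free n X, ∀ v ∈ free n X, ∀ w ∈ free n X, E u v = true → E v w = true → u ≠ w →
    E u w = true

theorem paths_eq_nil_iff {E : ℕ → ℕ → Bool} {n : ℕ} {X : List ℕ} :
    paths E n X = [] ↔ IsCluster E n X := by
  rw [List.eq_nil_iff_forall_not_mem]
  constructor
  · intro h u hu v hv w hw h₁ h₂ h₃
    by_contra h₄
    exact h (u, (v, w)) (mem_paths.2 ⟨⟨hu, hv, hw⟩, h₁, h₂, h₃, by simpa using h₄⟩)
  · rintro h ⟨u, v, w⟩ hp
    obtain ⟨⟨hu, hv, hw⟩, h₁, h₂, h₃, h₄⟩ := mem_paths.1 hp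
    simp [h u hu v hv w hw h₁ h₂ h₃] at h₄

section Clusters

variable {E : ℕ → ℕ → Bool} {n : ℕ} {X : List ℕ}

theorem rep_spec {v : ℕ} (hv : v ∈ free n X) :
    rep E n X v ∈ free n X ∧ (rep E n X v = v ∨ E (rep E n X v) v = true) := by
  unfold rep
  cases h : (free n X).filter fun u => Nat.beq u v || E u v with
  | nil =>
    have := List.filter_eq_nil_iff.1 h v hv
    simp at this
  | cons u l =>
    have : u ∈ (free n X).filter fun u => Nat.beq u v || E u v := by simp [h]
    simpa using this

/-- Adjacent vertices of a cluster graph have the same closed neighborhood, hence the same filtered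
list and the same head. Conversely, vertices that are equal or adjacent to a common representative
are equal or adjacent to each other. -/
theorem rep_eq_rep_iff (hE : IsGraph E) (hX : IsCluster E n X) {u v : ℕ} (hu : u ∈ free n X)
    (hv : v ∈ free n X) : rep E n X u = rep E n X v ↔ u = v ∨ E u v = true := by
  constructor
  · intro h
    obtain ⟨h₁, h₂⟩ := rep_spec (E := E) hu
    obtain ⟨-, h₃⟩ := rep_spec (E := E) hv
    rw [← h] at h₃
    generalize rep E n X u = r at *
    by_cases huv : u = v
    · exact Or.inl huv
    · rcases h₂ with rfl | h₂
      · exact h₃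
      · rcases h₃ with rfl | h₃
        · exact Or.inr (hE.symm _ _ h₂)
        · exact Or.inr (hX u hu r h₁ v hv (hE.symm _ _ h₂) h₃ huv)
  · rintro (rfl | h)
    · rfl
    · have : (free n X).filter (fun w => Nat.beq w u || E w u) =
          (free n X).filter fun w => Nat.beq w v || E w v := by
        refine List.filter_congr fun w hw => ?_
        rw [Bool.eq_iff_iff]
        simp only [Bool.or_eq_true, Nat.beq_eq]
        constructor
        · rintro (rfl | h')
          · exact Or.inr h
          · by_cases hwv : w = v
            · exact Or.inl hwv
            · exact Or.inr (hX w hw u hu v hv h' h hwv)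
        · rintro (rfl | h')
          · exact Or.inr (hE.symm _ _ h)
          · by_cases hwu : w = u
            · exact Or.inl hwu
            · exact Or.inr (hX w hw v hv u hu h' (hE.symm _ _ h) hwu)
      unfold rep
      rw [← this]
      cases h : (free n X).filter fun w => Nat.beq w u || E w u with
      | nil =>
        have := List.filter_eq_nil_iff.1 h u hu
        simp at this
      | cons w l => rfl

theorem mem_reps {q : ℕ} : q ∈ reps E n X ↔ q ∈ free n X ∧ rep E n X q = q := by
  simp [reps]

theorem rep_mem_reps (hE : IsGraph E) (hX : IsCluster E n X) {v : ℕ} (hv : v ∈ free n X) :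
    rep E n X v ∈ reps E n X := by
  obtain ⟨h₁, h₂⟩ := rep_spec (E := E) hv
  exact mem_reps.2 ⟨h₁, (rep_eq_rep_iff hE hX h₁ hv).2 h₂⟩

end Clusters

/-! ## Extending a coloring of a cluster deletion set -/

/-- `φ` is a proper coloring of the vertices below `n` that respects the budgets. -/
structure IsValid (E : ℕ → ℕ → Bool) (n : ℕ) (B : List ℕ) (φ : ℕ → ℕ) : Prop where
  lt : ∀ v < n, φ v < B.length
  proper : ∀ u < n, ∀ v < n, E u v = true → φ u ≠ φ v
  budget : ∀ y < B.length, ((Finset.range n).filter fun v => φ v = y).card ≤ B.getD y 0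

/-- The number of vertices with color `y` in a list of vertices with their colors. -/
def used (Z : List (ℕ × ℕ)) (y : ℕ) : ℕ := (Z.filter fun p => Nat.beq p.2 y).length

/-- The partial coloring `Z` is proper and respects the budgets. -/
def admissible (E : ℕ → ℕ → Bool) (B : List ℕ) (Z : List (ℕ × ℕ)) : Bool :=
  (Z.all fun p => Nat.ble (p.2 + 1) B.length && Z.all fun q => !(E p.1 q.1 && Nat.beq p.2 q.2)) &&
    (List.range B.length).all fun y => Nat.ble (used Z y) (B.getD y 0)

/-- The slots for a vertex: its cluster with the colors that are not used in its neighborhood. -/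
def slots (E : ℕ → ℕ → Bool) (n c : ℕ) (X : List ℕ) (Z : List (ℕ × ℕ)) (v : ℕ) : List Slot :=
  ((List.range c).filter fun y => Z.all fun p => !(Nat.beq p.2 y && E v p.1)).map fun y =>
    (rep E n X v, y)

/-- The vertices outside `X`, and for each color as many dummies as there are clusters that must
not use the color. -/
def bidders (E : ℕ → ℕ → Bool) (n : ℕ) (B X : List ℕ) (Z : List (ℕ × ℕ)) : List Bidder :=
  ((free n X).map fun v => ((v, 0), slots E n B.length X Z v)) ++
    (List.range B.length).flatMap fun y =>
      (List.range ((reps E n X).length - (B.getD y 0 - used Z y))).map fun e =>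
        ((y, e + 1), (reps E n X).map fun q => (q, y))

/-- The partial coloring `Z` of `X` extends to a valid coloring. -/
def extendable (E : ℕ → ℕ → Bool) (n : ℕ) (B X : List ℕ) (Z : List (ℕ × ℕ)) : Bool :=
  admissible E B Z && auction (bidders E n B X Z)
    (((reps E n X).length * B.length + 1) * ((reps E n X).length * B.length + 1))

section Extend

variable {E : ℕ → ℕ → Bool} {n : ℕ} {B X : List ℕ} {Z : List (ℕ × ℕ)}

theorem admissible_eq_true_iff : admissible E B Z = true ↔
    (∀ p ∈ Z, p.2 < B.length ∧ ∀ q ∈ Z, E p.1 q.1 = true → p.2 ≠ q.2) ∧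
      ∀ y < B.length, used Z y ≤ B.getD y 0 := by
  simp only [admissible, Bool.and_eq_true, List.all_eq_true, Nat.ble_eq, Nat.succ_le_iff,
    Bool.not_eq_true', Bool.and_eq_false_imp, List.mem_range, Nat.beq_eq_decide,
    decide_eq_false_iff_not, ne_eq]

theorem mem_slots {v : ℕ} {r : Slot} : r ∈ slots E n B.length X Z v ↔
    r.1 = rep E n X v ∧ r.2 < B.length ∧ ∀ p ∈ Z, p.2 = r.2 → E v p.1 = false := by
  obtain ⟨q, y⟩ := r
  simp only [slots, List.mem_map, List.mem_filter, List.mem_range, List.all_eq_true,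
    Nat.beq_eq_decide, Prod.mk.injEq, Bool.not_eq_true', Bool.and_eq_false_imp, decide_eq_true_eq]
  constructor
  · rintro ⟨y', ⟨h₁, h₂⟩, h₃, rfl⟩
    exact ⟨h₃.symm, h₁, h₂⟩
  · rintro ⟨h₁, h₂, h₃⟩
    exact ⟨y, ⟨h₂, h₃⟩, h₁.symm, rfl⟩

theorem mem_bidders {b : Bidder} : b ∈ bidders E n B X Z ↔
    (∃ v ∈ free n X, b = ((v, 0), slots E n B.length X Z v)) ∨
    ∃ y < B.length, ∃ e < (reps E n X).length - (B.getD y 0 - used Z y),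
      b = ((y, e + 1), (reps E n X).map fun q => (q, y)) := by
  simp only [bidders, List.mem_append, List.mem_map, List.mem_flatMap, List.mem_range,
    eq_comm (a := b)]

theorem nodup_bidders : (bidders E n B X Z).Nodup := by
  rw [bidders, List.nodup_append]
  refine ⟨(nodup_free n X).map fun u v h => ?_, ?_, ?_⟩
  · exact congrArg (fun b : Bidder => b.1.1) h
  · rw [List.nodup_flatMap]
    refine ⟨fun y _ => List.nodup_range.map fun e e' h => ?_, ?_⟩
    · simpa using congrArg (fun b : Bidder => b.1.2) h
    · refine List.nodup_range.imp fun {y y'} hne => ?_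
      rw [Function.onFun, List.disjoint_left]
      intro b h₁ h₂
      obtain ⟨e, -, rfl⟩ := List.mem_map.1 h₁
      obtain ⟨e', -, h⟩ := List.mem_map.1 h₂
      exact hne (congrArg (fun b : Bidder => b.1.1) h).symm
  · intro b h₁ b' h₂ h
    obtain ⟨v, -, rfl⟩ := List.mem_map.1 h₁
    obtain ⟨y, -, h₂⟩ := List.mem_flatMap.1 h₂
    obtain ⟨e, -, rfl⟩ := List.mem_map.1 h₂
    simpa using congrArg (fun b : Bidder => b.1.2) h

theorem used_eq_card {φ : ℕ → ℕ} (hZ : Z.map Prod.fst = X) (hX : X.Nodup)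
    (hφ : ∀ p ∈ Z, φ p.1 = p.2) (y : ℕ) : used Z y = (X.toFinset.filter fun v => φ v = y).card := by
  have h : (X.toFinset.filter fun v => φ v = y) = (X.filter fun v => φ v = y).toFinset := by
    ext v; simp
  rw [h, List.toFinset_card_of_nodup (hX.filter _), ← hZ, List.filter_map,
    List.length_map, used]
  congr 1
  refine List.filter_congr fun p hp => ?_
  rw [Bool.eq_iff_iff]
  simp [hφ p hp]

theorem card_eq_used_add {φ : ℕ → ℕ} (hZ : Z.map Prod.fst = X) (hX : X.Nodup)
    (hXn : ∀ v ∈ X, v < n) (hφ : ∀ p ∈ Z, φ p.1 = p.2) (y : ℕ) :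
    ((Finset.range n).filter fun v => φ v = y).card =
      used Z y + ((free n X).toFinset.filter fun v => φ v = y).card := by
  rw [used_eq_card hZ hX hφ, ← Finset.card_union_of_disjoint]
  · congr 1
    ext v
    simp only [Finset.mem_filter, Finset.mem_range, Finset.mem_union, List.mem_toFinset, mem_free]
    have := hXn v
    tauto
  · rw [Finset.disjoint_left]
    intro v h₁ h₂
    simp only [Finset.mem_filter, List.mem_toFinset, mem_free] at h₁ h₂
    exact h₂.1.2 h₁.1

/-- The color of a vertex outside `X` is the second component of its slot. Two vertices of one
cluster get different slots with the same first component, hence different colors; conflicts with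
`X` are excluded by `slots`. -/
theorem isValid_of_matching (hE : IsGraph E) (hcl : IsCluster E n X)
    (hZ : Z.map Prod.fst = X) (hX : X.Nodup) (hXn : ∀ v ∈ X, v < n)
    (hadm : admissible E B Z = true) {g : Bidder → Slot}
    (hg : Set.InjOn g {b | b ∈ bidders E n B X Z}) (hgL : ∀ b ∈ bidders E n B X Z, g b ∈ b.2) :
    ∃ φ, IsValid E n B φ ∧ ∀ p ∈ Z, φ p.1 = p.2 := by
  classical
  obtain ⟨hadm₁, hadm₂⟩ := admissible_eq_true_iff.1 hadm
  let bid : ℕ → Bidder := fun v => ((v, 0), slots E n B.length X Z v)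
  have hbid : ∀ v ∈ free n X, bid v ∈ bidders E n B X Z := fun v hv =>
    mem_bidders.2 (Or.inl ⟨v, hv, rfl⟩)
  let φ : ℕ → ℕ := fun v => if h : ∃ y, (v, y) ∈ Z then h.choose else (g (bid v)).2
  have hφZ : ∀ p ∈ Z, φ p.1 = p.2 := by
    rintro ⟨v, y⟩ hp
    have h : ∃ y, (v, y) ∈ Z := ⟨y, hp⟩
    have e := List.inj_on_of_nodup_map (hZ ▸ hX : (Z.map Prod.fst).Nodup) h.choose_spec hp rfl
    simp only [φ, dif_pos h]
    exact congrArg Prod.snd e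
  have hXZ : ∀ v, v ∈ X ↔ ∃ y, (v, y) ∈ Z := fun v => by
    rw [← hZ, List.mem_map]
    exact ⟨fun ⟨p, hp, e⟩ => ⟨p.2, by rw [← e]; exact hp⟩, fun ⟨y, hy⟩ => ⟨_, hy, rfl⟩⟩
  have hφfree : ∀ v ∈ free n X, g (bid v) = (rep E n X v, φ v) ∧ φ v < B.length ∧
      ∀ p ∈ Z, p.2 = φ v → E v p.1 = false := by
    intro v hv
    have h : ¬ ∃ y, (v, y) ∈ Z := fun h => (mem_free.1 hv).2 ((hXZ v).2 h)
    have e : φ v = (g (bid v)).2 := by simp only [φ, dif_neg h]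
    rw [e]
    obtain ⟨h₁, h₂, h₃⟩ := mem_slots.1 (hgL _ (hbid v hv))
    exact ⟨Prod.ext h₁ rfl, h₂, h₃⟩
  have hcases : ∀ v < n, (∃ y, (v, y) ∈ Z) ∨ v ∈ free n X := fun v hv => by
    rw [mem_free, ← hXZ]; tauto
  refine ⟨φ, ⟨fun v hv => ?_, fun u hu v hv huv => ?_, fun y hy => ?_⟩, hφZ⟩
  · rcases hcases v hv with ⟨y, hy⟩ | hv
    · rw [hφZ _ hy]; exact (hadm₁ _ hy).1
    · exact (hφfree v hv).2.1
  · rcases hcases u hu with ⟨y, hy⟩ | hu <;> rcases hcases v hv with ⟨z, hz⟩ | hv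
    · rw [hφZ _ hy, hφZ _ hz]
      exact (hadm₁ _ hy).2 _ hz huv
    · intro e
      have := (hφfree v hv).2.2 _ hy ((hφZ _ hy).symm.trans e)
      simp [hE.symm _ _ huv] at this
    · intro e
      have := (hφfree u hu).2.2 _ hz ((hφZ _ hz).symm.trans e.symm)
      simp [huv] at this
    · intro e
      have e' : g (bid u) = g (bid v) := by
        rw [(hφfree u hu).1, (hφfree v hv).1, e, (rep_eq_rep_iff hE hcl hu hv).2 (Or.inr huv)]
      have := congrArg (fun b : Bidder => b.1.1) (hg (hbid u hu) (hbid v hv) e')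
      simp only [bid] at this
      rw [this, hE.irrefl] at huv
      simp at huv
  · rw [card_eq_used_add hZ hX hXn hφZ]
    set F := (free n X).toFinset.filter fun v => φ v = y with hF
    have hFm : ∀ v ∈ F, v ∈ free n X ∧ φ v = y := fun v hv => by
      simpa [hF] using hv
    set D := (reps E n X).length - (B.getD y 0 - used Z y) with hD
    let dum : ℕ → Bidder := fun e => ((y, e + 1), (reps E n X).map fun q => (q, y))
    have hdum : ∀ e < D, dum e ∈ bidders E n B X Z := fun e he =>
      mem_bidders.2 (Or.inr ⟨y, hy, e, he, rfl⟩)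
    have h₁ : (F.image fun v => g (bid v)).card = F.card :=
      Finset.card_image_of_injOn fun u hu v hv e => congrArg (fun b : Bidder => b.1.1)
        (hg (hbid u (hFm u hu).1) (hbid v (hFm v hv).1) e)
    have h₂ : ((Finset.range D).image fun e => g (dum e)).card = D := by
      rw [Finset.card_image_of_injOn, Finset.card_range]
      intro e he e' he' h
      have := congrArg (fun b : Bidder => b.1.2) (hg (hdum e (by simpa using he))
        (hdum e' (by simpa using he')) h)
      simpa [dum] using this
    have h₃ : Disjoint (F.image fun v => g (bid v)) ((Finset.range D).image fun e => g (dum e)) := by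
      rw [Finset.disjoint_left]
      intro r hr hr'
      obtain ⟨v, hv, rfl⟩ := Finset.mem_image.1 hr
      obtain ⟨e, he, h⟩ := Finset.mem_image.1 hr'
      have := congrArg (fun b : Bidder => b.1.2)
        (hg (hdum e (by simpa using he)) (hbid v (hFm v hv).1) h)
      simp [dum, bid] at this
    -- The vertices of color `y` outside `X` and the dummies of `y` occupy different slots among the
    -- pairs (cluster, `y`). Hence `F.card + D` is at most the number of clusters, which by the
    -- choice of `D` leaves `F.card ≤ B.getD y 0 - used Z y`.
    have h₄ : (F.image fun v => g (bid v)) ∪ ((Finset.range D).image fun e => g (dum e)) ⊆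
        (reps E n X).toFinset.image fun q => (q, y) := by
      intro r hr
      rcases Finset.mem_union.1 hr with hr | hr
      · obtain ⟨v, hv, rfl⟩ := Finset.mem_image.1 hr
        obtain ⟨hvf, e⟩ := hFm v hv
        rw [(hφfree v hvf).1, e]
        exact Finset.mem_image_of_mem (fun q => (q, y))
          (List.mem_toFinset.2 (rep_mem_reps hE hcl hvf))
      · obtain ⟨e, he, rfl⟩ := Finset.mem_image.1 hr
        have := hgL _ (hdum e (by simpa using he))
        simpa [dum] using this
    have h₅ := (Finset.card_le_card h₄).trans Finset.card_image_le
    rw [Finset.card_union_of_disjoint h₃, h₁, h₂,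
      List.toFinset_card_of_nodup (nodup_reps E n X)] at h₅
    have := hadm₂ y hy
    omega

/-- Each vertex takes its cluster and its color. The budget of `y` leaves at least as many clusters
without color `y` as there are dummies of `y`, so the `e`-th dummy takes the `e`-th such cluster. -/
theorem exists_matching_of_isValid (hE : IsGraph E) (hcl : IsCluster E n X)
    (hZ : Z.map Prod.fst = X) (hX : X.Nodup) (hXn : ∀ v ∈ X, v < n) {φ : ℕ → ℕ}
    (hφ : IsValid E n B φ) (hφZ : ∀ p ∈ Z, φ p.1 = p.2) :
    ∃ g : Bidder → Slot, Set.InjOn g {b | b ∈ bidders E n B X Z} ∧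
      ∀ b ∈ bidders E n B X Z, g b ∈ b.2 := by
  classical
  let U : ℕ → List ℕ := fun y =>
    (reps E n X).filter fun q => decide (∀ v ∈ free n X, φ v = y → rep E n X v ≠ q)
  have hU : ∀ y < B.length, (reps E n X).length - (B.getD y 0 - used Z y) ≤ (U y).length := by
    intro y hy
    have h₁ := hφ.budget y hy
    rw [card_eq_used_add hZ hX hXn hφZ] at h₁
    set F := (free n X).toFinset.filter fun v => φ v = y with hF
    have h₂ : (U y).toFinset = (reps E n X).toFinset \ F.image (rep E n X) := by
      ext q
      simp [U, hF]
    have h₃ := congrArg Finset.card h₂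
    rw [List.toFinset_card_of_nodup ((nodup_reps E n X).filter _)] at h₃
    change (U y).length = _ at h₃
    have h₄ := Finset.le_card_sdiff (F.image (rep E n X)) (reps E n X).toFinset
    rw [List.toFinset_card_of_nodup (nodup_reps E n X)] at h₄
    have h₅ : (F.image (rep E n X)).card ≤ F.card := Finset.card_image_le
    omega
  -- The second label is `0` for vertices and positive for dummies. The default of `getD` is never
  -- used on actual bidders, by `hU`.
  let g : Bidder → Slot := fun b =>
    if b.1.2 = 0 then (rep E n X b.1.1, φ b.1.1) else ((U b.1.1).getD (b.1.2 - 1) 0, b.1.1)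
  have hg₀ : ∀ v N, g ((v, 0), N) = (rep E n X v, φ v) := fun v N => rfl
  have hg₁ : ∀ y e N, g ((y, e + 1), N) = ((U y).getD e 0, y) := fun y e N => rfl
  have hmem : ∀ y e, e < (U y).length → (U y).getD e 0 ∈ reps E n X ∧
      ∀ v ∈ free n X, φ v = y → rep E n X v ≠ (U y).getD e 0 := by
    intro y e he
    rw [List.getD_eq_getElem _ _ he]
    have := List.getElem_mem he
    simpa [U] using List.mem_filter.1 this
  refine ⟨g, ?_, ?_⟩
  · intro b hb b' hb' h
    rcases mem_bidders.1 hb with ⟨v, hv, rfl⟩ | ⟨y, hy, e, he, rfl⟩ <;>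
      rcases mem_bidders.1 hb' with ⟨v', hv', rfl⟩ | ⟨y', hy', e', he', rfl⟩
    · rw [hg₀, hg₀, Prod.mk.injEq] at h
      rcases (rep_eq_rep_iff hE hcl hv hv').1 h.1 with rfl | h'
      · rfl
      · exact absurd h.2 (hφ.proper _ (mem_free.1 hv).1 _ (mem_free.1 hv').1 h')
    · rw [hg₀, hg₁, Prod.mk.injEq] at h
      exact absurd h.1 ((hmem y' e' (he'.trans_le (hU y' hy'))).2 v hv h.2)
    · rw [hg₀, hg₁, Prod.mk.injEq] at h
      exact absurd h.1.symm ((hmem y e (he.trans_le (hU y hy))).2 v' hv' h.2.symm)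
    · rw [hg₁, hg₁, Prod.mk.injEq] at h
      obtain ⟨h, rfl⟩ := h
      rw [List.getD_eq_getElem _ _ (he.trans_le (hU y hy)),
        List.getD_eq_getElem _ _ (he'.trans_le (hU y hy)),
        ((nodup_reps E n X).filter _).getElem_inj_iff] at h
      rw [h]
  · intro b hb
    rcases mem_bidders.1 hb with ⟨v, hv, rfl⟩ | ⟨y, hy, e, he, rfl⟩
    · rw [hg₀, mem_slots]
      refine ⟨rfl, hφ.lt v (mem_free.1 hv).1, fun p hp h => ?_⟩
      by_contra hadj
      have hpX : p.1 ∈ X := hZ ▸ List.mem_map_of_mem hp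
      exact hφ.proper v (mem_free.1 hv).1 p.1 (hXn _ hpX) (by simpa using hadj)
        ((hφZ p hp).trans h).symm
    · rw [hg₁]
      exact List.mem_map.2 ⟨_, (hmem y e (he.trans_le (hU y hy))).1, rfl⟩

theorem admissible_of_isValid (hZ : Z.map Prod.fst = X) (hX : X.Nodup) (hXn : ∀ v ∈ X, v < n)
    {φ : ℕ → ℕ} (hφ : IsValid E n B φ) (hφZ : ∀ p ∈ Z, φ p.1 = p.2) :
    admissible E B Z = true := by
  have hn : ∀ p ∈ Z, p.1 < n := fun p hp => hXn _ (hZ ▸ List.mem_map_of_mem hp)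
  refine admissible_eq_true_iff.2 ⟨fun p hp => ⟨?_, fun q hq h => ?_⟩, fun y hy => ?_⟩
  · rw [← hφZ p hp]; exact hφ.lt _ (hn p hp)
  · rw [← hφZ p hp, ← hφZ q hq]; exact hφ.proper _ (hn p hp) _ (hn q hq) h
  · have := hφ.budget y hy
    rw [card_eq_used_add hZ hX hXn hφZ] at this
    omega

theorem extendable_eq_true_iff (hE : IsGraph E) (hcl : IsCluster E n X)
    (hZ : Z.map Prod.fst = X) (hX : X.Nodup) (hXn : ∀ v ∈ X, v < n) :
    extendable E n B X Z = true ↔ ∃ φ, IsValid E n B φ ∧ ∀ p ∈ Z, φ p.1 = p.2 := by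
  have hauc := auction_eq_true_iff (nodup_bidders (E := E) (n := n) (B := B) (X := X) (Z := Z))
    (R := (reps E n X).toFinset ×ˢ Finset.range B.length) (fun b hb r hr => ?_)
    (fuel := ((reps E n X).length * B.length + 1) * ((reps E n X).length * B.length + 1)) ?_
  · rw [extendable, Bool.and_eq_true, hauc]
    constructor
    · rintro ⟨hadm, g, hg, hgL⟩
      exact isValid_of_matching hE hcl hZ hX hXn hadm hg hgL
    · rintro ⟨φ, hφ, hφZ⟩
      exact ⟨admissible_of_isValid hZ hX hXn hφ hφZ,
        exists_matching_of_isValid hE hcl hZ hX hXn hφ hφZ⟩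
  · rw [Finset.mem_product, List.mem_toFinset, Finset.mem_range]
    rcases mem_bidders.1 hb with ⟨v, hv, rfl⟩ | ⟨y, hy, e, he, rfl⟩
    · obtain ⟨h₁, h₂, -⟩ := mem_slots.1 hr
      rw [h₁]
      exact ⟨rep_mem_reps hE hcl hv, h₂⟩
    · obtain ⟨q, hq, rfl⟩ := List.mem_map.1 hr
      exact ⟨hq, hy⟩
  -- With `N` slots the fuel is `(N + 1) * (N + 1)`, just above the required `N * (N + 1)`.
  · rw [Finset.card_product, Finset.card_range, List.toFinset_card_of_nodup (nodup_reps E n X)]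
    exact Nat.mul_lt_mul_of_pos_right (Nat.lt_succ_self _) (Nat.succ_pos _)

end Extend

/-! ## The search for a coloring of a cluster deletion set -/

/-- The colors that are not used yet and have budget at least `s`. -/
def suitable (B acc : List ℕ) (s : ℕ) : List ℕ :=
  (List.range B.length).filter fun y => (!acc.any fun z => Nat.beq y z) && Nat.ble s (B.getD y 0)

/-- A suitable color with least budget. -/
def leastSuitable (B acc : List ℕ) (s : ℕ) : ℕ :=
  ((suitable B acc s).filter fun y =>
    (suitable B acc s).all fun z => Nat.ble (B.getD y 0) (B.getD z 0)).headD B.length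

/-- The color of the next vertex. A digit `e ≤ d` opens a new color class, with `e` vertices outside
the deletion set; any other digit points to an earlier vertex with the same color. -/
def nextColor (B : List ℕ) (d : ℕ) (a acc : List ℕ) (e : ℕ) : ℕ :=
  bif Nat.ble e d then
    leastSuitable B acc (e + 1 + (a.filter fun e' => Nat.beq e' (d + 1 + acc.length)).length)
  else min (acc.getD (e - (d + 1)) 0) B.length

def colors (B : List ℕ) (d : ℕ) (a : List ℕ) : List ℕ :=
  a.foldl (fun acc e => acc ++ [nextColor B d a acc e]) []

def colorPairs (X col : List ℕ) : List (ℕ × ℕ) :=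
  (List.range X.length).map fun i => (X.getD i 0, col.getD i 0)

/-- The digits `a` lead to a valid coloring. -/
def leaf (E : ℕ → ℕ → Bool) (n : ℕ) (B X : List ℕ) (a : List ℕ) : Bool :=
  extendable E n B X (colorPairs X (colors B (reps E n X).length a))

def radices (k d : ℕ) : List ℕ := (List.range k).map fun i => d + 1 + i

theorem mem_suitable {B acc : List ℕ} {s y : ℕ} :
    y ∈ suitable B acc s ↔ y < B.length ∧ y ∉ acc ∧ s ≤ B.getD y 0 := by
  simp only [suitable, List.mem_filter, List.mem_range, Bool.and_eq_true, Bool.not_eq_true',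
    List.any_eq_false, Nat.beq_eq, Nat.ble_eq]
  exact and_congr_right fun _ => and_congr_left fun _ =>
    ⟨fun h hv => h y hv rfl, fun h x hx e => h (e ▸ hx)⟩

theorem leastSuitable_spec {B acc : List ℕ} {s x : ℕ} (hx : x ∈ suitable B acc s) :
    leastSuitable B acc s ∈ suitable B acc s ∧
      B.getD (leastSuitable B acc s) 0 ≤ B.getD x 0 := by
  obtain ⟨y, hy, hmin⟩ := (suitable B acc s).toFinset.exists_min_image (fun y => B.getD y 0)
    ⟨x, by simpa using hx⟩
  simp only [List.mem_toFinset] at hy hmin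
  unfold leastSuitable
  cases h : (suitable B acc s).filter fun y =>
      (suitable B acc s).all fun z => Nat.ble (B.getD y 0) (B.getD z 0) with
  | nil =>
    have := List.filter_eq_nil_iff.1 h y hy
    simp only [List.all_eq_true, Nat.ble_eq] at this
    exact absurd hmin this
  | cons z l =>
    have : z ∈ (suitable B acc s).filter fun y =>
      (suitable B acc s).all fun z => Nat.ble (B.getD y 0) (B.getD z 0) := by
      rw [h]; exact List.mem_cons_self
    simp only [List.mem_filter, List.all_eq_true, Nat.ble_eq] at this
    exact ⟨this.1, this.2 x hx⟩

theorem leastSuitable_le (B acc : List ℕ) (s : ℕ) : leastSuitable B acc s ≤ B.length := by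
  unfold leastSuitable
  cases h : (suitable B acc s).filter fun y =>
      (suitable B acc s).all fun z => Nat.ble (B.getD y 0) (B.getD z 0) with
  | nil => rfl
  | cons z l =>
    have : z ∈ suitable B acc s := List.mem_of_mem_filter (h ▸ List.mem_cons_self)
    exact (mem_suitable.1 this).1.le

/-- This keeps the list of colors polynomially small for arbitrary digits. The value `B.length` is
not a color: it marks a failed choice and is rejected by `admissible`. -/
theorem nextColor_le (B : List ℕ) (d : ℕ) (a acc : List ℕ) (e : ℕ) :
    nextColor B d a acc e ≤ B.length := by
  unfold nextColor
  cases Nat.ble e d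
  · exact min_le_right _ _
  · exact leastSuitable_le _ _ _

theorem map_getD_range (X : List ℕ) : ((List.range X.length).map fun i => X.getD i 0) = X := by
  refine List.ext_getElem (by simp) fun i h₁ h₂ => ?_
  simp [h₂]

theorem length_filter_range {k : ℕ} {p : ℕ → Bool} {q : ℕ → Prop} [DecidablePred q]
    (h : ∀ i < k, p i = true ↔ q i) :
    ((List.range k).filter p).length = ((Finset.range k).filter q).card := by
  have : (Finset.range k).filter q = ((List.range k).filter p).toFinset := by
    ext i
    simp only [Finset.mem_filter, Finset.mem_range, List.mem_toFinset, List.mem_filter,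
      List.mem_range]
    exact and_congr_right fun hi => (h i hi).symm
  rw [this, List.toFinset_card_of_nodup (List.nodup_range.filter _)]

theorem colorPairs_map_fst (X col : List ℕ) : (colorPairs X col).map Prod.fst = X := by
  simpa [colorPairs, Function.comp_def] using map_getD_range X

/-! ### Every valid coloring can be normalized to a greedy one. -/

section Exchange

variable {E : ℕ → ℕ → Bool} {n : ℕ} {B X : List ℕ}

open Classical in
/-- The digit for the `i`-th vertex of `X` in a coloring. -/
noncomputable def code (n : ℕ) (X : List ℕ) (d : ℕ) (φ : ℕ → ℕ) (i : ℕ) : ℕ :=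
  if h : ∃ j < i, φ (X.getD j 0) = φ (X.getD i 0) then d + 1 + Nat.find h
  else ((free n X).toFinset.filter fun v => φ v = φ (X.getD i 0)).card

theorem code_lt {d : ℕ} {φ : ℕ → ℕ}
    (hd : ∀ y, ((free n X).toFinset.filter fun v => φ v = y).card ≤ d) (i : ℕ) :
    code n X d φ i < d + 1 + i := by
  classical
  unfold code
  split_ifs with h
  · have := (Nat.find_spec h).1
    omega
  · have := hd (φ (X.getD i 0))
    omega

/-- Pointers always go to the first vertex of a class, so they can be counted there. Digits that
open a class are at most `d` and cannot be confused with pointers. -/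
theorem code_eq_iff {d : ℕ} {φ : ℕ → ℕ} {m i : ℕ}
    (hd : ∀ y, ((free n X).toFinset.filter fun v => φ v = y).card ≤ d)
    (hm : ¬ ∃ j < m, φ (X.getD j 0) = φ (X.getD m 0)) :
    code n X d φ i = d + 1 + m ↔ i ≠ m ∧ m ≤ i ∧ φ (X.getD i 0) = φ (X.getD m 0) := by
  classical
  unfold code
  split_ifs with h
  · rw [Nat.add_left_cancel_iff, Nat.find_eq_iff]
    constructor
    · rintro ⟨⟨h₁, h₂⟩, -⟩
      exact ⟨by omega, by omega, h₂.symm⟩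
    · rintro ⟨h₁, h₂, h₃⟩
      refine ⟨⟨by omega, h₃.symm⟩, fun j hj => ?_⟩
      rintro ⟨-, h₅⟩
      exact hm ⟨j, hj, h₅.trans h₃⟩
  · have := hd (φ (X.getD i 0))
    refine ⟨fun h' => by omega, ?_⟩
    rintro ⟨h₁, h₂, h₃⟩
    exact absurd ⟨m, by omega, h₃.symm⟩ h

/-- The three summands count the part of the class outside `X`, its first vertex in `X`, and the
later ones, which point to the first. This is the size that `nextColor` demands of a new color. -/
theorem class_card_eq {d : ℕ} {φ : ℕ → ℕ} {m : ℕ} (hX : X.Nodup) (hXn : ∀ v ∈ X, v < n)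
    (hd : ∀ y, ((free n X).toFinset.filter fun v => φ v = y).card ≤ d)
    (hm : ¬ ∃ j < m, φ (X.getD j 0) = φ (X.getD m 0)) (hmX : m < X.length) :
    code n X d φ m + 1 + (((List.range X.length).map (code n X d φ)).filter
      fun e => Nat.beq e (d + 1 + m)).length =
      ((Finset.range n).filter fun v => φ v = φ (X.getD m 0)).card := by
  classical
  have hZ : (X.map fun v => (v, φ v)).map Prod.fst = X := by simp [Function.comp_def]
  rw [card_eq_used_add hZ hX hXn (by simp)]
  have h₁ : code n X d φ m = ((free n X).toFinset.filter fun v => φ v = φ (X.getD m 0)).card := by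
    unfold code
    rw [dif_neg hm]
  have h₂ : used (X.map fun v => (v, φ v)) (φ (X.getD m 0)) =
      ((Finset.range X.length).filter fun i => φ (X.getD i 0) = φ (X.getD m 0)).card := by
    rw [used]
    generalize φ (X.getD m 0) = y
    conv_lhs => rw [← map_getD_range X]
    rw [List.map_map, List.filter_map, List.length_map]
    exact length_filter_range fun i _ => by simp
  have h₃ : (((List.range X.length).map (code n X d φ)).filter
      fun e => Nat.beq e (d + 1 + m)).length =
      (((Finset.range X.length).filter fun i => φ (X.getD i 0) = φ (X.getD m 0)).erase m).card := by
    rw [List.filter_map, List.length_map, length_filter_range (q := fun i =>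
      i ≠ m ∧ φ (X.getD i 0) = φ (X.getD m 0)) fun i _ => ?_]
    · congr 1
      ext i
      simp only [Finset.mem_filter, Finset.mem_erase]
      tauto
    · rw [Function.comp_apply, Nat.beq_eq, code_eq_iff hd hm]
      refine and_congr_right fun _ => ⟨fun h => h.2, fun h => ⟨?_, h⟩⟩
      by_contra hlt
      exact hm ⟨i, by omega, h⟩
  have h₄ := Finset.card_erase_add_one (a := m)
    (s := (Finset.range X.length).filter fun i => φ (X.getD i 0) = φ (X.getD m 0)) (by simpa using hmX)
  omega

/-- After the swap, `y` carries the old class of `x`, which fits by `hcard`, and `x` carries the old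
class of `y`, which fits since the budget of `x` is no smaller. -/
theorem IsValid.swap {φ : ℕ → ℕ} (hφ : IsValid E n B φ) {x y : ℕ} (hx : x < B.length)
    (hy : y < B.length) (hxy : B.getD y 0 ≤ B.getD x 0)
    (hcard : ((Finset.range n).filter fun v => φ v = x).card ≤ B.getD y 0) :
    IsValid E n B fun v => Equiv.swap x y (φ v) := by
  refine ⟨fun v hv => ?_, fun u hu v hv huv h => ?_, fun z hz => ?_⟩
  · have := hφ.lt v hv
    rw [Equiv.swap_apply_def]
    split_ifs <;> assumption
  · exact hφ.proper u hu v hv huv ((Equiv.swap x y).injective h)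
  · have h : ((Finset.range n).filter fun v => Equiv.swap x y (φ v) = z) =
        (Finset.range n).filter fun v => φ v = Equiv.swap x y z := by
      refine Finset.filter_congr fun v _ => ?_
      rw [Equiv.swap_apply_eq_iff]
    rw [h]
    by_cases h₁ : z = x
    · rw [h₁, Equiv.swap_apply_left]
      exact (hφ.budget y hy).trans hxy
    · by_cases h₂ : z = y
      · rw [h₂, Equiv.swap_apply_right]
        exact hcard
      · rw [Equiv.swap_apply_of_ne_of_ne h₁ h₂]
        exact hφ.budget z hz

/-- Induction on prefixes of `X`: a valid coloring with the same classes as `φ` agrees with the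
greedy colors so far. As the digits depend only on the classes, they stay those of `φ` while the
colors are permuted. -/
theorem exists_colors_eq {d : ℕ} {φ : ℕ → ℕ} (hX : X.Nodup) (hXn : ∀ v ∈ X, v < n)
    (hd : ∀ y, ((free n X).toFinset.filter fun v => φ v = y).card ≤ d) (hφ : IsValid E n B φ) :
    ∃ ψ, IsValid E n B ψ ∧
      colors B d ((List.range X.length).map (code n X d φ)) = X.map ψ := by
  set a := (List.range X.length).map (code n X d φ) with ha
  have hlt : ∀ i < X.length, X.getD i 0 < n := fun i hi => by
    rw [List.getD_eq_getElem _ _ hi]; exact hXn _ (List.getElem_mem hi)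
  have key : ∀ m ≤ X.length, ∃ ψ, IsValid E n B ψ ∧ (∀ u v, ψ u = ψ v ↔ φ u = φ v) ∧
      ((List.range m).map (code n X d φ)).foldl (fun acc e => acc ++ [nextColor B d a acc e]) [] =
        (List.range m).map fun i => ψ (X.getD i 0) := by
    intro m hm
    induction m with
    | zero => exact ⟨φ, hφ, fun _ _ => Iff.rfl, rfl⟩
    | succ m ih =>
      obtain ⟨ψ, hψ, hker, hcol⟩ := ih (by omega)
      simp only [List.range_succ, List.map_append, List.foldl_append, List.map_cons, List.map_nil,
        List.foldl_cons, List.foldl_nil, hcol]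
      by_cases h : ∃ j < m, φ (X.getD j 0) = φ (X.getD m 0)
      · refine ⟨ψ, hψ, hker, ?_⟩
        classical
        have hc : code n X d φ m = d + 1 + Nat.find h := by unfold code; rw [dif_pos h]
        obtain ⟨h₁, h₂⟩ := Nat.find_spec h
        generalize Nat.find h = j at hc h₁ h₂
        have e : d + 1 + j - (d + 1) = j := by omega
        have h₃ : Nat.ble (d + 1 + j) d = false := by
          rw [Nat.ble_eq_decide]; simp; omega
        have h₄ := hψ.lt _ (hlt m (by omega))
        rw [hc, nextColor, h₃, e, List.getD_eq_getElem _ _ (by simpa using h₁)]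
        simp only [cond_false, List.getElem_map, List.getElem_range, (hker _ _).2 h₂]
        rw [min_eq_left h₄.le]
      · have hcard := class_card_eq hX hXn hd h (by omega)
        rw [← ha] at hcard
        have hcode : code n X d φ m ≤ d := by
          unfold code; rw [dif_neg h]; exact hd _
        set acc := (List.range m).map fun i => ψ (X.getD i 0) with hacc
        have hlen : acc.length = m := by simp [hacc]
        have hker' : ((Finset.range n).filter fun v => φ v = φ (X.getD m 0)) =
            (Finset.range n).filter fun v => ψ v = ψ (X.getD m 0) :=
          Finset.filter_congr fun v _ => (hker _ _).symm
        rw [hker'] at hcard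
        have hnext : nextColor B d a acc (code n X d φ m) = leastSuitable B acc
            ((Finset.range n).filter fun v => ψ v = ψ (X.getD m 0)).card := by
          rw [nextColor, hlen, hcard, Nat.ble_eq_true_of_le hcode, cond_true]
        -- The color that `ψ` gives to the new class is itself a candidate, so the greedy color
        -- exists and its budget is no larger.
        have hx : ψ (X.getD m 0) ∈ suitable B acc
            ((Finset.range n).filter fun v => ψ v = ψ (X.getD m 0)).card := by
          have hl := hψ.lt _ (hlt m (by omega))
          refine mem_suitable.2 ⟨hl, fun hmem => ?_, hψ.budget _ hl⟩
          obtain ⟨j, hj, e⟩ := List.mem_map.1 hmem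
          exact h ⟨j, List.mem_range.1 hj, (hker _ _).1 e⟩
        obtain ⟨hy, hle⟩ := leastSuitable_spec hx
        rw [hnext]
        generalize leastSuitable B acc
          ((Finset.range n).filter fun v => ψ v = ψ (X.getD m 0)).card = y at hy hle
        have hx' := mem_suitable.1 hx
        have hy' := mem_suitable.1 hy
        -- Neither of the swapped colors occurs in `acc`, so the colors of the earlier vertices stay
        -- as they are.
        refine ⟨_, hψ.swap hx'.1 hy'.1 hle hy'.2.2, fun u v => ?_, ?_⟩
        · rw [Equiv.apply_eq_iff_eq, hker]
        · simp only [Equiv.swap_apply_left]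
          congr 1
          refine List.map_congr_left fun j hj => ?_
          have hj' : ψ (X.getD j 0) ∈ acc := List.mem_map_of_mem hj
          rw [Equiv.swap_apply_of_ne_of_ne]
          · exact fun e => hx'.2.1 (e ▸ hj')
          · exact fun e => hy'.2.1 (e ▸ hj')
  obtain ⟨ψ, hψ, -, h⟩ := key X.length le_rfl
  refine ⟨ψ, hψ, h.trans ?_⟩
  refine List.ext_getElem (by simp) fun i h₁ h₂ => ?_
  simp at h₂
  simp [h₂]

/-- Soundness needs nothing about the digits, because `leaf` checks that the coloring of `X`
extends. Completeness takes the digits of a valid coloring. -/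
theorem exists_leaf_iff (hE : IsGraph E) (hcl : IsCluster E n X) (hX : X.Nodup)
    (hXn : ∀ v ∈ X, v < n) :
    (∃ a, List.Forall₂ (· < ·) a (radices X.length (reps E n X).length) ∧
      leaf E n B X a = true) ↔ ∃ φ, IsValid E n B φ := by
  constructor
  · rintro ⟨a, -, h⟩
    obtain ⟨φ, hφ, -⟩ :=
      (extendable_eq_true_iff hE hcl (colorPairs_map_fst _ _) hX hXn).1 h
    exact ⟨φ, hφ⟩
  · rintro ⟨φ, hφ⟩
    -- On a color class outside `X` the map to representatives is injective, since distinct vertices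
    -- of one cluster are adjacent.
    have hd : ∀ y, ((free n X).toFinset.filter fun v => φ v = y).card ≤ (reps E n X).length := by
      intro y
      rw [← List.toFinset_card_of_nodup (nodup_reps E n X)]
      refine Finset.card_le_card_of_injOn (rep E n X) (fun v hv => ?_) fun u hu v hv h => ?_
      · simp only [Finset.coe_filter, List.mem_toFinset, Set.mem_ofPred_eq] at hv
        simpa using rep_mem_reps hE hcl hv.1
      · simp only [Finset.coe_filter, List.mem_toFinset, Set.mem_ofPred_eq] at hu hv
        refine ((rep_eq_rep_iff hE hcl hu.1 hv.1).1 h).resolve_right fun huv => ?_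
        exact hφ.proper u (mem_free.1 hu.1).1 v (mem_free.1 hv.1).1 huv (hu.2.trans hv.2.symm)
    obtain ⟨ψ, hψ, hcol⟩ := exists_colors_eq hX hXn hd hφ
    refine ⟨(List.range X.length).map (code n X (reps E n X).length φ), ?_, (extendable_eq_true_iff hE hcl (colorPairs_map_fst _ _) hX hXn).2
      ⟨ψ, hψ, ?_⟩⟩
    · rw [radices, List.forall₂_map_left_iff, List.forall₂_map_right_iff]
      exact List.forall₂_same.2 fun i _ => code_lt hd i
    · rw [hcol]
      intro p hp
      obtain ⟨i, hi, rfl⟩ := List.mem_map.1 hp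
      rw [List.mem_range] at hi
      simp [hi]

end Exchange

/-! ## The search for a cluster deletion set -/

/-- Add a vertex of the first induced path to `X`. -/
def branchStep (E : ℕ → ℕ → Bool) (n : ℕ) (X : List ℕ) (e : ℕ) : List ℕ :=
  listCases (paths E n X) X fun p _ =>
    (bif Nat.beq e 0 then p.1 else bif Nat.beq e 1 then p.2.1 else p.2.2) :: X

def branch (E : ℕ → ℕ → Bool) (n : ℕ) (w : List ℕ) : List ℕ := w.foldl (branchStep E n) []

/-- The last digit bounds the number of clusters, the other digits lead to a cluster deletion set. -/
def isDeletion (E : ℕ → ℕ → Bool) (n : ℕ) (v : List ℕ) : Bool :=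
  listCases v.reverse false fun d w =>
    (paths E n (branch E n w)).isEmpty && Nat.ble (reps E n (branch E n w)).length d

section

variable {E : ℕ → ℕ → Bool} {n : ℕ}

theorem branchStep_cases (X : List ℕ) (e : ℕ) :
    branchStep E n X e = X ∨ ∃ v ∈ free n X, branchStep E n X e = v :: X := by
  unfold branchStep
  cases h : paths E n X with
  | nil => exact Or.inl rfl
  | cons p l =>
    have hp : (p.1, (p.2.1, p.2.2)) ∈ paths E n X := by rw [h]; exact List.mem_cons_self
    obtain ⟨⟨h₁, h₂, h₃⟩, -⟩ := mem_paths.1 hp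
    refine Or.inr ⟨_, ?_, rfl⟩
    cases Nat.beq e 0 <;> cases Nat.beq e 1 <;> assumption

theorem branch_spec (w : List ℕ) : (branch E n w).Nodup ∧ (∀ v ∈ branch E n w, v < n) ∧
    (branch E n w).length ≤ w.length := by
  induction w using List.reverseRecOn with
  | nil => simp [branch]
  | append_singleton w e ih =>
    obtain ⟨h₁, h₂, h₃⟩ := ih
    simp only [branch, List.foldl_append, List.foldl_cons, List.foldl_nil] at *
    rcases branchStep_cases (E := E) (n := n) (w.foldl (branchStep E n) []) e with h | ⟨v, hv, h⟩
    · rw [h]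
      exact ⟨h₁, h₂, by simp; omega⟩
    · rw [h]
      rw [mem_free] at hv
      refine ⟨List.nodup_cons.2 ⟨hv.2, h₁⟩, fun u hu => ?_, by simpa using h₃⟩
      rcases List.mem_cons.1 hu with rfl | hu
      · exact hv.1
      · exact h₂ u hu

theorem free_congr {X Y : List ℕ} (h : ∀ v, v ∈ X ↔ v ∈ Y) : free n X = free n Y := by
  unfold free
  congr 1
  funext v
  congr 1
  rw [Bool.eq_iff_iff]
  simp only [List.any_eq_true, h]

theorem isCluster_congr {X Y : List ℕ} (h : ∀ v, v ∈ X ↔ v ∈ Y) :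
    IsCluster E n X ↔ IsCluster E n Y := by
  unfold IsCluster; rw [free_congr h]

theorem reps_congr {X Y : List ℕ} (h : ∀ v, v ∈ X ↔ v ∈ Y) : reps E n X = reps E n Y := by
  unfold reps rep; rw [free_congr h]

theorem mem_iff_of_subset {X S : List ℕ} (hX : X.Nodup) (h : ∀ v ∈ X, v ∈ S)
    (hl : S.length ≤ X.length) : ∀ v, v ∈ X ↔ v ∈ S := by
  intro v
  have := ((List.subperm_of_subset hX h).perm_of_length_le hl).mem_iff (a := v)
  exact this

/-- As long as an induced path remains, one of its vertices is in `S`, and the digit that selects it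
keeps the branch inside `S`. If no path remains early, the word is padded with zeros. -/
theorem exists_branch {S : List ℕ} (hcl : IsCluster E n S) :
    ∃ w : List ℕ, w.length = S.length ∧ (∀ e ∈ w, e < 3) ∧ (∀ v ∈ branch E n w, v ∈ S) ∧
      IsCluster E n (branch E n w) := by
  have key : ∀ m, ∃ w : List ℕ, w.length = m ∧ (∀ e ∈ w, e < 3) ∧ (∀ v ∈ branch E n w, v ∈ S) ∧
      (IsCluster E n (branch E n w) ∨ (branch E n w).length = m) := by
    intro m
    induction m with
    | zero => exact ⟨[], rfl, by simp, by simp [branch], Or.inr rfl⟩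
    | succ m ih =>
      obtain ⟨w, hw, hd, hb, h⟩ := ih
      have hstep : ∀ e, branch E n (w ++ [e]) = branchStep E n (branch E n w) e := fun e => by
        simp [branch]
      have happ : ∀ e < 3, (w ++ [e]).length = m + 1 ∧ ∀ e' ∈ w ++ [e], e' < 3 := fun e he => by
        refine ⟨by simp [hw], fun e' he' => ?_⟩
        rcases List.mem_append.1 he' with h | h
        · exact hd e' h
        · rw [List.mem_singleton.1 h]; exact he
      cases hp : paths E n (branch E n w) with
      | nil =>
        have hs : branch E n (w ++ [0]) = branch E n w := by
          rw [hstep, branchStep, hp]; rfl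
        refine ⟨w ++ [0], (happ 0 (by omega)).1, (happ 0 (by omega)).2, ?_, ?_⟩
        · rwa [hs]
        · rw [hs]; exact Or.inl (paths_eq_nil_iff.1 hp)
      | cons p l =>
        have hlen : (branch E n w).length = m := h.resolve_left fun hc => by
          rw [paths_eq_nil_iff.2 hc] at hp; simp at hp
        have hmem : (p.1, (p.2.1, p.2.2)) ∈ paths E n (branch E n w) := by
          rw [hp]; exact List.mem_cons_self
        obtain ⟨⟨h₁, h₂, h₃⟩, h₄, h₅, h₆, h₇⟩ := mem_paths.1 hmem
        have hin : ∃ e < 3,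
            (bif Nat.beq e 0 then p.1 else bif Nat.beq e 1 then p.2.1 else p.2.2) ∈ S := by
          by_contra hno
          push Not at hno
          have i₁ := hno 0 (by omega)
          have i₂ := hno 1 (by omega)
          have i₃ := hno 2 (by omega)
          simp only [Nat.beq_eq_decide] at i₁ i₂ i₃
          have := hcl p.1 (mem_free.2 ⟨(mem_free.1 h₁).1, by simpa using i₁⟩)
            p.2.1 (mem_free.2 ⟨(mem_free.1 h₂).1, by simpa using i₂⟩)
            p.2.2 (mem_free.2 ⟨(mem_free.1 h₃).1, by simpa using i₃⟩) h₄ h₅ h₆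
          simp [this] at h₇
        obtain ⟨e, he, heS⟩ := hin
        have hs : branch E n (w ++ [e]) =
            (bif Nat.beq e 0 then p.1 else bif Nat.beq e 1 then p.2.1 else p.2.2) ::
              branch E n w := by
          rw [hstep, branchStep, hp]; rfl
        refine ⟨w ++ [e], (happ e he).1, (happ e he).2, fun v hv => ?_, Or.inr ?_⟩
        · rw [hs] at hv
          rcases List.mem_cons.1 hv with rfl | hv
          · exact heS
          · exact hb v hv
        · rw [hs, List.length_cons, hlen]
  obtain ⟨w, hw, hd, hb, h⟩ := key S.length
  refine ⟨w, hw, hd, hb, h.elim id fun hl => ?_⟩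
  -- A repetition-free sublist of `S` that is as long as `S` has the same elements.
  exact (isCluster_congr (mem_iff_of_subset (branch_spec w).1 hb hl.ge)).2 hcl

theorem isDeletion_append (w : List ℕ) (d : ℕ) : isDeletion E n (w ++ [d]) = true ↔
    IsCluster E n (branch E n w.reverse) ∧ (reps E n (branch E n w.reverse)).length ≤ d := by
  simp [isDeletion, paths_eq_nil_iff]

/-- The first success of the search, when the minimum size of a cluster deletion set is `k`. -/
theorem isDeletion_search {S : List ℕ} (hcl : IsCluster E n S)
    (hmin : ∀ X : List ℕ, X.Nodup → (∀ v ∈ X, v < n) → IsCluster E n X → S.length ≤ X.length) :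
    (∀ k < S.length, ∀ m, isDeletion E n (digits (List.replicate k 3 ++ [n + 1]) m) = false) ∧
    (∃ m < (List.replicate S.length 3 ++ [n + 1]).prod,
      isDeletion E n (digits (List.replicate S.length 3 ++ [n + 1]) m) = true) ∧
    ∀ m < (List.replicate S.length 3 ++ [n + 1]).prod,
      isDeletion E n (digits (List.replicate S.length 3 ++ [n + 1]) m) = true →
      (∀ i < m, isDeletion E n (digits (List.replicate S.length 3 ++ [n + 1]) i) = false) →
      IsCluster E n (branch E n (digits (List.replicate S.length 3) m).reverse) ∧
      (branch E n (digits (List.replicate S.length 3) m).reverse).length ≤ S.length ∧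
      (reps E n (branch E n (digits (List.replicate S.length 3) m).reverse)).length ≤
        (reps E n S).length := by
  have hsmall : ∀ k m, isDeletion E n (digits (List.replicate k 3 ++ [n + 1]) m) = true →
      IsCluster E n (branch E n (digits (List.replicate k 3) m).reverse) ∧
      (reps E n (branch E n (digits (List.replicate k 3) m).reverse)).length ≤
        m / 3 ^ k % (n + 1) ∧
      (branch E n (digits (List.replicate k 3) m).reverse).length ≤ k := by
    intro k m h
    rw [digits_append_singleton, isDeletion_append, List.prod_replicate] at h
    exact ⟨h.1, h.2, (branch_spec _).2.2.trans (by simp)⟩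
  obtain ⟨w, hw, hd, hb, hc⟩ := exists_branch hcl
  -- By minimality the deletion set found inside `S` has the same elements as `S`, hence the same
  -- clusters.
  have hreps : reps E n (branch E n w) = reps E n S :=
    reps_congr (mem_iff_of_subset (branch_spec w).1 hb
      (hmin _ (branch_spec w).1 (branch_spec w).2.1 hc))
  have hrn : (reps E n S).length < n + 1 := by
    have h₁ : (reps E n S).length ≤ (free n S).length := List.length_filter_le _ _
    have h₂ : (free n S).length ≤ (List.range n).length := List.length_filter_le _ _
    simp at h₂; omega
  obtain ⟨m₁, hm₁, hdig⟩ := exists_digits_eq (ρ := List.replicate S.length 3 ++ [n + 1])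
    (v := w.reverse ++ [(reps E n S).length]) (by
      refine List.rel_append ?_ (by simpa using hrn)
      rw [List.forall₂_iff_get]
      refine ⟨by simp [hw], fun i h₁ h₂ => ?_⟩
      have := hd (w.reverse.get ⟨i, h₁⟩) (by rw [← List.mem_reverse]; exact List.get_mem _ _)
      simpa using this)
  have hm₁' : isDeletion E n (digits (List.replicate S.length 3 ++ [n + 1]) m₁) = true := by
    rw [hdig, isDeletion_append, List.reverse_reverse, hreps]
    exact ⟨hc, le_rfl⟩
  refine ⟨fun k hk m => ?_, ⟨m₁, hm₁, hm₁'⟩, fun m hm h hfirst => ?_⟩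
  · by_contra h
    obtain ⟨h₁, -, h₂⟩ := hsmall k m (by simpa using h)
    have := hmin _ (branch_spec _).1 (branch_spec _).2.1 h₁
    omega
  · obtain ⟨h₁, h₂, h₃⟩ := hsmall _ m h
    refine ⟨h₁, h₃, h₂.trans ?_⟩
    -- The bound on the clusters is the most significant digit. The first success therefore comes no
    -- later than the tuple for `S`, and its last digit is no larger.
    have hle : m ≤ m₁ := by
      by_contra hlt
      rw [hfirst m₁ (by omega)] at hm₁'
      simp at hm₁'
    have hlast : m₁ / 3 ^ S.length % (n + 1) = (reps E n S).length := by
      rw [digits_append_singleton, List.prod_replicate] at hdig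
      exact (List.append_inj' hdig rfl).2 |> List.singleton_inj.1
    have hlt : m₁ / 3 ^ S.length < n + 1 := by
      rw [List.prod_append, List.prod_replicate, List.prod_singleton] at hm₁
      exact Nat.div_lt_of_lt_mul hm₁
    rw [Nat.mod_eq_of_lt hlt] at hlast
    rw [← hlast]
    exact (Nat.mod_le _ _).trans (Nat.div_le_div_right hle)

end

/-! ## Polynomial time -/

/-- The adjacency relation given by a matrix. -/
def adj (A : List (List Bool)) (u v : ℕ) : Bool := (A.getD u []).getD v false

section

variable {α : Type} [Enc α] {A : α → List (List Bool)} {n : α → ℕ} {X B : α → List ℕ}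
  {Z : α → List (ℕ × ℕ)}

@[fun_prop]
theorem poly_adj {u v : α → ℕ} (hA : Poly A) (hu : Poly u) (hv : Poly v) :
    Poly fun x => adj (A x) (u x) (v x) := by
  unfold adj; fun_prop

@[fun_prop]
theorem poly_free (hn : Poly n) (hX : Poly X) : Poly fun x => free (n x) (X x) := by
  unfold free; fun_prop

@[fun_prop]
theorem poly_paths (hA : Poly A) (hn : Poly n) (hX : Poly X) :
    Poly fun x => paths (adj (A x)) (n x) (X x) := by
  unfold paths; fun_prop

@[fun_prop]
theorem poly_rep {v : α → ℕ} (hA : Poly A) (hn : Poly n) (hX : Poly X) (hv : Poly v) :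
    Poly fun x => rep (adj (A x)) (n x) (X x) (v x) := by
  unfold rep; fun_prop

@[fun_prop]
theorem poly_reps (hA : Poly A) (hn : Poly n) (hX : Poly X) :
    Poly fun x => reps (adj (A x)) (n x) (X x) := by
  unfold reps; fun_prop

@[fun_prop]
theorem poly_used {y : α → ℕ} (hZ : Poly Z) (hy : Poly y) : Poly fun x => used (Z x) (y x) := by
  unfold used; fun_prop

@[fun_prop]
theorem poly_admissible (hA : Poly A) (hB : Poly B) (hZ : Poly Z) :
    Poly fun x => admissible (adj (A x)) (B x) (Z x) := by
  unfold admissible; fun_prop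

@[fun_prop]
theorem poly_slots {c v : α → ℕ} (hA : Poly A) (hn : Poly n) (hc : Poly c) (hX : Poly X)
    (hZ : Poly Z) (hv : Poly v) :
    Poly fun x => slots (adj (A x)) (n x) (c x) (X x) (Z x) (v x) := by
  unfold slots; fun_prop

@[fun_prop]
theorem poly_bidders (hA : Poly A) (hn : Poly n) (hB : Poly B) (hX : Poly X) (hZ : Poly Z) :
    Poly fun x => bidders (adj (A x)) (n x) (B x) (X x) (Z x) := by
  unfold bidders; fun_prop

@[fun_prop]
theorem poly_extendable (hA : Poly A) (hn : Poly n) (hB : Poly B) (hX : Poly X) (hZ : Poly Z) :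
    Poly fun x => extendable (adj (A x)) (n x) (B x) (X x) (Z x) := by
  unfold extendable; fun_prop

@[fun_prop]
theorem poly_suitable {s : α → ℕ} (hB : Poly B) (hX : Poly X) (hs : Poly s) :
    Poly fun x => suitable (B x) (X x) (s x) := by
  unfold suitable; fun_prop

@[fun_prop]
theorem poly_leastSuitable {s : α → ℕ} (hB : Poly B) (hX : Poly X) (hs : Poly s) :
    Poly fun x => leastSuitable (B x) (X x) (s x) := by
  unfold leastSuitable; fun_prop

@[fun_prop]
theorem poly_nextColor {d e : α → ℕ} {a : α → List ℕ} (hB : Poly B) (hd : Poly d) (ha : Poly a)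
    (hX : Poly X) (he : Poly e) : Poly fun x => nextColor (B x) (d x) (a x) (X x) (e x) := by
  unfold nextColor; fun_prop

@[fun_prop]
theorem poly_colors {d : α → ℕ} {a : α → List ℕ} (hB : Poly B) (hd : Poly d) (ha : Poly a) :
    Poly fun x => colors (B x) (d x) (a x) := by
  refine Poly.foldl_of_add (a₀ := fun _ => ([] : List ℕ))
    (step := fun x acc e => acc ++ [nextColor (B x) (d x) (a x) acc e]) ha
    (by fun_prop) (by fun_prop) ((PolyBdd.const 2).add ((PolyBdd.const 2).mul hB.polyBdd_sz))
    fun x acc e _ => ?_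
  have h₁ := nextColor_le (B x) (d x) (a x) acc e
  have h₂ := length_lt_sz (B x)
  have h₃ := sz_append acc [nextColor (B x) (d x) (a x) acc e]
  simp only [sz_list_cons, sz_list_nil, sz_nat] at h₃
  omega

@[fun_prop]
theorem poly_colorPairs {col : α → List ℕ} (hX : Poly X) (hcol : Poly col) :
    Poly fun x => colorPairs (X x) (col x) := by
  unfold colorPairs; fun_prop

@[fun_prop]
theorem poly_leaf {a : α → List ℕ} (hA : Poly A) (hn : Poly n) (hB : Poly B) (hX : Poly X)
    (ha : Poly a) : Poly fun x => leaf (adj (A x)) (n x) (B x) (X x) (a x) := by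
  unfold leaf; fun_prop

@[fun_prop]
theorem poly_radices {k d : α → ℕ} (hk : Poly k) (hd : Poly d) :
    Poly fun x => radices (k x) (d x) := by
  unfold radices; fun_prop

@[fun_prop]
theorem poly_branchStep {e : α → ℕ} (hA : Poly A) (hn : Poly n) (hX : Poly X) (he : Poly e) :
    Poly fun x => branchStep (adj (A x)) (n x) (X x) (e x) := by
  unfold branchStep; fun_prop

@[fun_prop]
theorem poly_branch {w : α → List ℕ} (hA : Poly A) (hn : Poly n) (hw : Poly w) :
    Poly fun x => branch (adj (A x)) (n x) (w x) := by
  refine Poly.foldl_of_add (a₀ := fun _ => ([] : List ℕ))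
    (step := fun x => branchStep (adj (A x)) (n x)) hw
    (by fun_prop) (by fun_prop) ((PolyBdd.const 2).add hn.polyBdd_sz) fun x X e _ => ?_
  rcases branchStep_cases (E := adj (A x)) (n := n x) X e with h | ⟨v, hv, h⟩
  · rw [h]; omega
  · have := (mem_free.1 hv).1
    rw [h]
    simp only [sz_list_cons, sz_nat]
    omega

@[fun_prop]
theorem poly_isDeletion {v : α → List ℕ} (hA : Poly A) (hn : Poly n) (hv : Poly v) :
    Poly fun x => isDeletion (adj (A x)) (n x) (v x) := by
  unfold isDeletion; fun_prop

end

open Enc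

/-! ## The program -/

/-- An adjacency matrix and the budgets in unary. -/
abbrev Ctx : Type := List (List Bool) × List ℕ

theorem length_le_of_nodup {n : ℕ} {S : List ℕ} (hS : S.Nodup) (hSn : ∀ v ∈ S, v < n) :
    S.length ≤ n := by
  rw [← List.toFinset_card_of_nodup hS, ← Finset.card_range n]
  exact Finset.card_le_card fun v hv => by simpa using hSn v (by simpa using hv)

theorem sz_deletion_radices (j n : ℕ) : sz (List.replicate j 3 ++ [n + 1]) = 8 * j + 2 * n + 5 := by
  have h₁ : sz (List.replicate j 3) = 8 * j + 1 := by
    induction j with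
    | zero => rfl
    | succ j ih => simp only [List.replicate_succ, sz_list_cons, ih, sz_nat]; ring
  have h₂ := sz_append (List.replicate j 3) [n + 1]
  simp only [h₁, sz_list_cons, sz_list_nil, sz_nat] at h₂
  omega

/-- The state of the search for a cluster deletion set: a flag that says whether the search goes on,
the radices of the digits to be searched, and the result. -/
abbrev DeletionState : Type := Bool × ((Ctx × List ℕ) × List (List ℕ))

/-- A program finds a cluster deletion set of minimum size `k` with the least number of clusters
in time `3 ^ k`, up to a polynomial factor. -/
theorem exists_deletion_program : ∃ (P : ℕ → Prog) (b : Ctx → ℕ), PolyBdd b ∧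
    ∀ (A : List (List Bool)) (B S : List ℕ), S.Nodup → (∀ v ∈ S, v < A.length) →
      IsCluster (adj A) A.length S →
      (∀ X : List ℕ, X.Nodup → (∀ v ∈ X, v < A.length) → IsCluster (adj A) A.length X →
        S.length ≤ X.length) →
      ∃ X : List ℕ, X.Nodup ∧ (∀ v ∈ X, v < A.length) ∧ IsCluster (adj A) A.length X ∧
        X.length = S.length ∧
        (reps (adj A) A.length X).length ≤ (reps (adj A) A.length S).length ∧
        Maps P (enc (A, B))
          (enc (((A, B), X), radices X.length (reps (adj A) A.length X).length))
          (3 ^ S.length * b (A, B)) := by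
  obtain ⟨Q, bQ, ⟨C₂, a₂, hbQ⟩, hQ⟩ := exists_search (α := Ctx)
    (pred := fun c v => isDeletion (adj c.1) c.1.length v) (by fun_prop)
  -- After a failed search the size of the deletion set is increased by one: one more ternary digit
  -- is put in front.
  let post : (Ctx × List ℕ) × List (List ℕ) → DeletionState := fun p =>
    listCases p.2 (true, ((p.1.1, 3 :: p.1.2), [])) fun _ _ => (false, (p.1, p.2))
  -- As in `isDeletion`, reversing puts the bound on the clusters first and `tail` drops it.
  let out : DeletionState → (Ctx × List ℕ) × List ℕ := fun s =>
    let X := branch (adj s.2.1.1.1) s.2.1.1.1.length (s.2.2.headD []).reverse.tail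
    ((s.2.1.1, X), radices X.length (reps (adj s.2.1.1.1) s.2.1.1.1.length X).length)
  have hinit : Poly fun c : Ctx => ((true, ((c, [c.1.length + 1]), [])) : DeletionState) := by
    fun_prop
  have hget : Poly fun s : DeletionState => s.2.1 := by fun_prop
  have hpost : Poly post := by fun_prop
  have hout : Poly out := by fun_prop
  obtain ⟨P₀, τ₀, hτ₀, -, hP₀⟩ := hinit
  obtain ⟨P₁, τ₁, ⟨C₁, a₁, hτ₁⟩, -, hP₁⟩ := hget
  obtain ⟨P₃, τ₃, ⟨C₃, a₃, hτ₃⟩, -, hP₃⟩ := hpost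
  obtain ⟨P₄, τ₄, ⟨C₄, a₄, hτ₄⟩, -, hP₄⟩ := hout
  let F : Ctx → ℕ := fun c => 100 + 40 * sz c
  have hF : PolyBdd F := (PolyBdd.const 100).add ((PolyBdd.const 40).mul .size)
  have hF' : ∀ C a, PolyBdd fun c => C * F c ^ a := fun C a => (PolyBdd.const C).mul (hF.pow a)
  let body := Maps.seqProg P₁ (Maps.seqProg (Maps.pairProg (Maps.exprProg id) Q) P₃)
  have hN : PolyBdd fun c : Ctx => sz c + 1 := PolyBdd.size.add (.const 1)
  refine ⟨Maps.seqProg P₀ (Maps.seqProg (Maps.whileProg body) P₄), _,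
    (hτ₀.add ((hN.mul ((((hF' C₁ a₁).add (.const 13)).add (hN.mul (hF' C₂ a₂))).add
      (hF' C₃ a₃))).add (.const 3))).add (hF' C₄ a₄), ?_⟩
  intro A B S hS hSn hcl hmin
  obtain ⟨hno, ⟨m₀, hm₀, hyes⟩, hfirst⟩ := isDeletion_search hcl hmin
  have hkn := length_le_of_nodup hS hSn
  have hnsz : A.length < sz (A, B) := by
    have := length_lt_sz A
    simp only [sz_pair]; omega
  set k := S.length with hk
  set n := A.length with hn
  let ρ : ℕ → List ℕ := fun j => List.replicate j 3 ++ [n + 1]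
  have hρpos : ∀ j, ∀ r ∈ ρ j, 0 < r := by
    intro j r hr
    rcases List.mem_append.1 hr with hr | hr
    · rw [List.eq_of_mem_replicate hr]; omega
    · rw [List.mem_singleton.1 hr]; omega
  have hρprod : ∀ j ≤ k, (ρ j).prod ≤ 3 ^ k * (n + 1) := by
    intro j hj
    simp only [ρ, List.prod_append, List.prod_replicate, List.prod_singleton]
    exact Nat.mul_le_mul_right _ (Nat.pow_le_pow_right (by omega) hj)
  have hρsz : ∀ j ≤ k, sz (ρ j) ≤ 10 * sz (A, B) + 5 := by
    intro j hj
    simp only [ρ, sz_deletion_radices]; omega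
  let st : ℕ → DeletionState := fun j => (true, (((A, B), ρ j), []))
  have hT : sz true = 3 := rfl
  have hT' : sz false = 1 := rfl
  -- Each of the `k + 1` rounds is charged like the last one, with `3 ^ k * (n + 1)` tuples; the
  -- number of rounds goes into the polynomial factor.
  have hstep : ∀ j ≤ k, ∀ res : List (List ℕ), sz res ≤ 10 * sz (A, B) + 10 →
      Maps Q (enc ((A, B), ρ j)) (enc res) ((ρ j).prod * bQ ((A, B), ρ j)) →
      Maps body (enc (st j)) (enc (post (((A, B), ρ j), res)))
        (C₁ * F (A, B) ^ a₁ + (2 + 3 ^ k * (n + 1) * (C₂ * F (A, B) ^ a₂) + 8 +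
          C₃ * F (A, B) ^ a₃)) := by
    intro j hj res hres hm
    have hs := hρsz j hj
    refine ((hP₁ (st j)).mono ((hτ₁ _).trans ?_)).seq ((Maps.pair (Maps.skip _)
      (hm.mono (Nat.mul_le_mul (hρprod j hj) ((hbQ _).trans ?_)))).seq
      ((hP₃ (((A, B), ρ j), res)).mono ((hτ₃ _).trans ?_)))
    all_goals
      refine Nat.mul_le_mul_left _ (Nat.pow_le_pow_left ?_ _)
      simp only [st, F, sz_prod (_, _), sz_list_nil, hT] at *
      omega
  have hsuc : ∃ m < (ρ k).prod, IsCluster (adj A) n (branch (adj A) n (digits (ρ k) m).reverse.tail) ∧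
      (branch (adj A) n (digits (ρ k) m).reverse.tail).length ≤ k ∧
      (reps (adj A) n (branch (adj A) n (digits (ρ k) m).reverse.tail)).length ≤
        (reps (adj A) n S).length ∧
      Maps Q (enc ((A, B), ρ k)) (enc [digits (ρ k) m]) ((ρ k).prod * bQ ((A, B), ρ k)) := by
    rcases hQ (A, B) (ρ k) (hρpos k) with ⟨m, hm, h₁, h₂, h₃⟩ | ⟨h₁, -⟩
    · obtain ⟨i₁, i₂, i₃⟩ := hfirst m hm h₁ h₂
      have e : (digits (ρ k) m).reverse.tail = (digits (List.replicate k 3) m).reverse := by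
        simp [ρ, digits_append_singleton]
      rw [← e] at i₁ i₂ i₃
      exact ⟨m, hm, i₁, i₂, i₃, h₃⟩
    · exact absurd hyes (by rw [h₁ m₀ hm₀]; simp)
  obtain ⟨m, hm, hX₁, hX₂, hX₃, hmap⟩ := hsuc
  obtain ⟨hX₄, hX₅, -⟩ := branch_spec (E := adj A) (n := n) (digits (ρ k) m).reverse.tail
  have hdsz := sz_digits_le m (hρpos k)
  have hksz := hρsz k le_rfl
  let fin : DeletionState := (false, (((A, B), ρ k), [digits (ρ k) m]))
  have hloop := Maps.while_loop (P := body) (k + 1)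
    (u := C₁ * F (A, B) ^ a₁ + (2 + 3 ^ k * (n + 1) * (C₂ * F (A, B) ^ a₂) + 8 +
          C₃ * F (A, B) ^ a₃)) (fun j => enc (if j < k + 1 then st j else fin))
    (fun j hj => ?_) (fun j hj => ?_) ?_
  · refine ⟨_, hX₄, hX₅, hX₁, le_antisymm hX₂ (hmin _ hX₄ hX₅ hX₁), hX₃, ?_⟩
    simp only [Nat.succ_pos, lt_irrefl, if_true, if_false] at hloop
    have h₄ := (hP₄ fin).mono (u := C₄ * F (A, B) ^ a₄) ((hτ₄ _).trans
      (Nat.mul_le_mul_left _ (Nat.pow_le_pow_left (by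
        simp only [fin, F, sz_prod (_, _), sz_list_cons, sz_list_nil, hT'] at *
        omega) _)))
    refine ((hP₀ (A, B)).seq (hloop.seq h₄)).mono ?_
    generalize C₁ * F (A, B) ^ a₁ = x₁
    generalize C₂ * F (A, B) ^ a₂ = x₂
    generalize C₃ * F (A, B) ^ a₃ = x₃
    generalize C₄ * F (A, B) ^ a₄ = x₄
    generalize τ₀ (A, B) = x₀
    generalize sz (A, B) = N at *
    have hq : 1 ≤ 3 ^ k := Nat.one_le_pow _ _ (by omega)
    generalize 3 ^ k = q at *
    have h₁ : x₁ + (2 + q * (n + 1) * x₂ + 8 + x₃) + 3 ≤ q * (x₁ + 13 + (N + 1) * x₂ + x₃) := by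
      have e₁ : q * (n + 1) * x₂ ≤ q * ((N + 1) * x₂) := by
        rw [mul_assoc]; gcongr
      have e₂ := Nat.le_mul_of_pos_left x₁ hq
      have e₃ := Nat.le_mul_of_pos_left x₃ hq
      simp only [mul_add] at *
      omega
    have h₂ : (k + 1) * (x₁ + (2 + q * (n + 1) * x₂ + 8 + x₃) + 3) ≤
        q * ((N + 1) * (x₁ + 13 + (N + 1) * x₂ + x₃)) := by
      rw [mul_left_comm]
      exact Nat.mul_le_mul (by omega) h₁
    have e₀ := Nat.le_mul_of_pos_left x₀ hq
    have e₄ := Nat.le_mul_of_pos_left x₄ hq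
    generalize (N + 1) * (x₁ + 13 + (N + 1) * x₂ + x₃) = M at *
    generalize (k + 1) * (x₁ + (2 + q * (n + 1) * x₂ + 8 + x₃) + 3) = L at *
    rw [show q * (x₀ + (M + 3) + x₄) = q * x₀ + (q * M + q * 3) + q * x₄ by ring]
    omega
  · rw [if_pos hj]
    by_cases hjk : j < k
    · rw [if_pos (by omega)]
      rcases hQ (A, B) (ρ j) (hρpos j) with ⟨m, hm, h₁, -⟩ | ⟨-, h₂⟩
      · exact absurd h₁ (by rw [hno j hjk m]; simp)
      · exact hstep j hjk.le [] (by simp) h₂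
    · have e : j = k := by omega
      rw [if_neg (by omega), e]
      exact hstep k le_rfl [digits (ρ k) m] (by simp only [sz_list_cons, sz_list_nil]; omega) hmap
  · simp [hj, st, enc_pair, enc_true, Data.hd]
  · simp [fin, enc_pair, enc_false, Data.hd]

/-! ### Budgets capped at the number of vertices. -/

/-- The minimum of `n` and the number with the given binary digits. -/
def capped (n : ℕ) (l : List Bool) : ℕ :=
  l.reverse.foldl (fun m b => min (bif b then m + m + 1 else m + m) n) 0

def budgets (n : ℕ) (bits : List (List Bool)) : List ℕ := bits.map (capped n)

/-- Capping after each bit agrees with capping at the end, since doubling a value that is at least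
`n` keeps it at least `n`. Unary intermediate values thus remain small. -/
theorem capped_bits (n m : ℕ) : capped n m.bits = min m n := by
  simp only [capped, List.foldl_reverse]
  induction m using Nat.strong_induction_on with
  | _ m ih =>
    rcases Nat.even_or_odd' m with ⟨k, rfl | rfl⟩
    · rcases Nat.eq_zero_or_pos k with rfl | hk
      · simp
      · rw [Nat.bit0_bits k hk.ne', List.foldr_cons, ih k (by omega)]
        simp only [cond_false]; omega
    · rw [Nat.bit1_bits, List.foldr_cons, ih k (by omega)]
      simp only [cond_true]; omega

theorem capped_le (n : ℕ) (l : List Bool) : capped n l ≤ n := by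
  simp only [capped, List.foldl_reverse]
  cases l with
  | nil => simp
  | cons b l => exact min_le_right _ _

@[fun_prop]
theorem poly_capped {α : Type} [Enc α] {n : α → ℕ} {l : α → List Bool} (hn : Poly n)
    (hl : Poly l) : Poly fun x => capped (n x) (l x) := by
  refine Poly.foldl (a₀ := fun _ => 0) (step := fun x m b => min (bif b then m + m + 1 else m + m)
    (n x)) hl.reverse (by fun_prop) (by fun_prop) hn.polyBdd_sz fun x l₁ _ _ => ?_
  have := capped_le (n x) l₁.reverse
  rw [capped, List.reverse_reverse] at this
  rw [sz_nat, sz_nat]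
  omega

@[fun_prop]
theorem poly_budgets {α : Type} [Enc α] {n : α → ℕ} {l : α → List (List Bool)} (hn : Poly n)
    (hl : Poly l) : Poly fun x => budgets (n x) (l x) := by
  unfold budgets; fun_prop

theorem forall₂_digits {ρ : List ℕ} (hρ : ∀ r ∈ ρ, 0 < r) (m : ℕ) :
    List.Forall₂ (· < ·) (digits ρ m) ρ := by
  induction ρ generalizing m with
  | nil => exact .nil
  | cons r ρ ih =>
    exact .cons (Nat.mod_lt _ (hρ r List.mem_cons_self))
      (ih (fun q hq => hρ q (List.mem_cons_of_mem _ hq)) _)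

/-- This absorbs the search for the deletion set into `k ^ k`; the constant is only needed for `k <
3`. -/
theorem three_pow_le (k : ℕ) : 3 ^ k ≤ 27 * k ^ k := by
  rcases Nat.lt_or_ge k 3 with h | h
  · interval_cases k <;> norm_num
  · calc 3 ^ k ≤ k ^ k := Nat.pow_le_pow_left h k
      _ ≤ 27 * k ^ k := by omega

/-- Since `d ≥ 1`, each factor satisfies `d' + 1 + i ≤ d * (i + 2)`, so the product is at most `d ^
k * (k + 1)!`; then `k! ≤ k ^ k`. -/
theorem prod_radices_le {k d d' : ℕ} (hd : d' ≤ d) (hk : k ≠ 0 → 1 ≤ d) :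
    (radices k d').prod ≤ (k + 1) * (d ^ k * k ^ k) := by
  have key : ∀ j ≤ k, (radices j d').prod ≤ d ^ j * (j + 1).factorial := by
    intro j hj
    induction j with
    | zero => simp [radices]
    | succ j ih =>
      have h := hk (by omega)
      have e : radices (j + 1) d' = radices j d' ++ [d' + 1 + j] := by
        simp [radices, List.range_succ]
      rw [e, List.prod_append, List.prod_singleton, Nat.factorial_succ (j + 1), pow_succ]
      calc (radices j d').prod * (d' + 1 + j)
          ≤ d ^ j * (j + 1).factorial * (d * (j + 1 + 1)) := by
            refine Nat.mul_le_mul (ih (by omega)) ?_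
            nlinarith
        _ = _ := by ring
  refine (key k le_rfl).trans ?_
  rw [Nat.factorial_succ, mul_left_comm]
  gcongr
  exact Nat.factorial_le_pow k

/-- If no vertex were left outside `S`, putting one back would leave at most a single vertex, still
a cluster graph, against minimality. Without this the factor `d ^ k` of the time bound could vanish.
-/
theorem reps_pos_of_min {E : ℕ → ℕ → Bool} {n : ℕ} {S : List ℕ} (hE : IsGraph E)
    (hcl : IsCluster E n S) (hS : S.Nodup) (hSn : ∀ v ∈ S, v < n)
    (hmin : ∀ X : List ℕ, X.Nodup → (∀ v ∈ X, v < n) → IsCluster E n X → S.length ≤ X.length)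
    (hk : S.length ≠ 0) : 1 ≤ (reps E n S).length := by
  by_contra hr
  have hfree : ∀ v, v ∉ free n S := fun v hv => by
    have := List.length_pos_of_mem (rep_mem_reps hE hcl hv)
    omega
  cases S with
  | nil => simp at hk
  | cons x S =>
    have hx : ∀ v ∈ free n S, v = x := fun v hv => by
      by_contra hne
      rw [mem_free] at hv
      exact hfree v (mem_free.2 ⟨hv.1, by simp [hne, hv.2]⟩)
    have := hmin S (List.nodup_cons.1 hS).2 (fun v hv => hSn v (List.mem_cons_of_mem _ hv))
      fun u hu v _ w hw _ _ huw => absurd ((hx u hu).trans (hx w hw).symm) huw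
    simp at this

/-- The input: an adjacency matrix and the budgets in binary. -/
abbrev Input : Type := List (List Bool) × List (List Bool)

/-- A program that decides whether there is a valid coloring. -/
theorem exists_program : ∃ (P : ℕ → Prog) (b : Input → ℕ), PolyBdd b ∧
    ∀ (A bits : List (List Bool)) (S : List ℕ), IsGraph (adj A) → S.Nodup →
      (∀ v ∈ S, v < A.length) → IsCluster (adj A) A.length S →
      (∀ X : List ℕ, X.Nodup → (∀ v ∈ X, v < A.length) → IsCluster (adj A) A.length X →
        S.length ≤ X.length) →
      ∃ y, Maps P (enc (A, bits)) y (b (A, bits) *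
          ((reps (adj A) A.length S).length ^ S.length * S.length ^ S.length)) ∧
        (y ≠ .nil ↔ ∃ φ, IsValid (adj A) A.length (budgets A.length bits) φ) := by
  obtain ⟨P₁, b₁, hb₁, hP₁⟩ := exists_deletion_program
  obtain ⟨P₂, b₂, ⟨C, a, hb₂⟩, hP₂⟩ := exists_search (α := Ctx × List ℕ)
    (pred := fun c v => leaf (adj c.1.1) c.1.1.length c.1.2 c.2 v) (by fun_prop)
  have hctx : Poly fun x : Input => ((x.1, budgets x.1.length x.2) : Ctx) := by fun_prop
  obtain ⟨P₀, τ₀, hτ₀, hs₀, hP₀⟩ := hctx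
  have hN : PolyBdd fun x : Input => sz x + 1 := PolyBdd.size.add (.const 1)
  have hF : PolyBdd fun x : Input => sz ((x.1, budgets x.1.length x.2) : Ctx) +
      20 * ((sz x + 1) * (sz x + 1)) := hs₀.add ((PolyBdd.const 20).mul (hN.mul hN))
  refine ⟨Maps.seqProg P₀ (Maps.seqProg P₁ P₂), _,
    (hτ₀.add ((PolyBdd.const 27).mul (hb₁.comp hs₀))).add
      (hN.mul ((PolyBdd.const C).mul (hF.pow a))), ?_⟩
  intro A bits S hE hS hSn hcl hmin
  set B := budgets A.length bits with hB
  obtain ⟨X, hX, hXn, hXcl, hXk, hXd, hmap⟩ := hP₁ A B S hS hSn hcl hmin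
  have hkn := length_le_of_nodup hS hSn
  have hnsz : A.length < sz (A, bits) := by
    have := length_lt_sz A
    simp only [sz_pair]; omega
  have hdn : (reps (adj A) A.length X).length ≤ A.length :=
    length_le_of_nodup (nodup_reps _ _ _) fun v hv => (mem_free.1 (mem_reps.1 hv).1).1
  have hpos := reps_pos_of_min hE hcl hS hSn hmin
  set d := (reps (adj A) A.length S).length with hd
  set d' := (reps (adj A) A.length X).length with hd'
  set ρ := radices X.length d' with hρ
  have hρpos : ∀ r ∈ ρ, 0 < r := fun r hr => by
    obtain ⟨i, -, rfl⟩ := List.mem_map.1 hr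
    omega
  have hprod : ρ.prod ≤ (S.length + 1) * (d ^ S.length * S.length ^ S.length) := by
    rw [hρ, hXk]
    exact prod_radices_le hXd hpos
  have hW : S.length ^ S.length ≤ d ^ S.length * S.length ^ S.length := by
    refine Nat.le_mul_of_pos_left _ ?_
    by_cases hk : S.length = 0
    · simp [hk]
    · exact Nat.pow_pos (hpos hk)
  have hW' : 1 ≤ S.length ^ S.length := Nat.pow_self_pos
  have hsz : sz (((A, B), X), ρ) ≤ sz (A, B) +
      20 * ((sz (A, bits) + 1) * (sz (A, bits) + 1)) := by
    have h₁ : sz X ≤ 1 + X.length * (1 + (2 * sz (A, bits) + 1)) :=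
      sz_list_le fun v hv => by have := hXn v hv; rw [sz_nat]; omega
    have h₂ : sz ρ ≤ 1 + ρ.length * (1 + (4 * sz (A, bits) + 3)) :=
      sz_list_le fun r hr => by
        obtain ⟨i, hi, rfl⟩ := List.mem_map.1 hr
        rw [List.mem_range] at hi
        rw [sz_nat]; omega
    have h₃ : ρ.length = X.length := by simp [hρ, radices]
    have h₄ : X.length ≤ sz (A, bits) := by omega
    rw [h₃] at h₂
    have h₅ := h₁.trans (Nat.add_le_add_left (Nat.mul_le_mul_right _ h₄) _)
    have h₆ := h₂.trans (Nat.add_le_add_left (Nat.mul_le_mul_right _ h₄) _)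
    rw [sz_pair, sz_pair ((A, B) : Ctx)]
    nlinarith
  have hfin : ∀ y, Maps P₂ (enc (((A, B), X), ρ)) y (ρ.prod * b₂ (((A, B), X), ρ)) →
      Maps (Maps.seqProg P₀ (Maps.seqProg P₁ P₂)) (enc (A, bits)) y
        ((τ₀ (A, bits) + 27 * b₁ (A, B) + (sz (A, bits) + 1) * (C * (sz (A, B) +
          20 * ((sz (A, bits) + 1) * (sz (A, bits) + 1))) ^ a)) *
          (d ^ S.length * S.length ^ S.length)) := by
    intro y hy
    refine ((hP₀ (A, bits)).seq (hmap.seq hy)).mono ?_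
    have i₁ : 3 ^ S.length * b₁ (A, B) ≤
        27 * b₁ (A, B) * (d ^ S.length * S.length ^ S.length) :=
      calc 3 ^ S.length * b₁ (A, B) ≤ 27 * (d ^ S.length * S.length ^ S.length) * b₁ (A, B) :=
            Nat.mul_le_mul_right _ ((three_pow_le _).trans (Nat.mul_le_mul_left _ hW))
        _ = _ := by ring
    have i₂ : ρ.prod * b₂ (((A, B), X), ρ) ≤ (sz (A, bits) + 1) * (C * (sz (A, B) +
          20 * ((sz (A, bits) + 1) * (sz (A, bits) + 1))) ^ a) *
          (d ^ S.length * S.length ^ S.length) :=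
      calc ρ.prod * b₂ (((A, B), X), ρ) ≤
            ((sz (A, bits) + 1) * (d ^ S.length * S.length ^ S.length)) * (C * (sz (A, B) +
              20 * ((sz (A, bits) + 1) * (sz (A, bits) + 1))) ^ a) := by
            refine Nat.mul_le_mul (hprod.trans (Nat.mul_le_mul_right _ (by omega)))
              ((hb₂ _).trans (Nat.mul_le_mul_left _ (Nat.pow_le_pow_left hsz _)))
        _ = _ := by ring
    have i₃ := Nat.le_mul_of_pos_right (τ₀ (A, bits)) (hW'.trans hW)
    rw [add_mul, add_mul]
    omega
  have hiff := exists_leaf_iff (B := B) hE hXcl hX hXn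
  rcases hP₂ ((A, B), X) ρ hρpos with ⟨m, hm, h₁, -, h₂⟩ | ⟨h₁, h₂⟩
  · refine ⟨_, hfin _ h₂, ?_⟩
    rw [← hiff]
    exact iff_of_true (by simp [enc_list_cons]) ⟨_, forall₂_digits hρpos m, h₁⟩
  · refine ⟨_, hfin _ h₂, ?_⟩
    rw [← hiff]
    refine iff_of_false (by simp [enc_list_nil]) ?_
    rintro ⟨v, hv, hleaf⟩
    obtain ⟨m, hm, rfl⟩ := exists_digits_eq hv
    exact absurd (hleaf.symm.trans (h₁ m hm)) (by simp)

/-! ## Instances -/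

theorem enc_eq_ofList {α : Type} [Enc α] (l : List α) : enc l = Data.ofList (l.map enc) := by
  induction l with
  | nil => rfl
  | cons a l ih => rw [enc_list_cons, ih]; rfl

section

open Classical in
/-- The adjacency matrix of a graph. -/
noncomputable def matrix {n : ℕ} (G : SimpleGraph (Fin n)) : List (List Bool) :=
  List.ofFn fun u => List.ofFn fun v => decide (G.Adj u v)

/-- The budgets in binary. -/
def binaryBudgets {c : ℕ} (b : Fin c → ℕ) : List (List Bool) := List.ofFn fun i => (b i).bits

theorem encode_eq (I : BCPInstance) : I.encode = enc (matrix I.G, binaryBudgets I.b) := by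
  rw [enc_pair, enc_eq_ofList, enc_eq_ofList, matrix, binaryBudgets, List.map_ofFn, List.map_ofFn,
    BCPInstance.encode]
  congr 3
  · funext u
    simp only [Function.comp_apply]
    rw [enc_eq_ofList, List.map_ofFn]
    rfl
  · funext i
    simp only [Function.comp_apply]
    rw [enc_eq_ofList, Data.ofNat]
    rfl

variable {n : ℕ} (G : SimpleGraph (Fin n))

theorem length_matrix : (matrix G).length = n := by simp [matrix]

theorem adj_matrix_iff (u v : ℕ) :
    adj (matrix G) u v = true ↔ ∃ (hu : u < n) (hv : v < n), G.Adj ⟨u, hu⟩ ⟨v, hv⟩ := by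
  by_cases hu : u < n <;> by_cases hv : v < n <;> simp [adj, matrix, hu, hv]

theorem isGraph_matrix : IsGraph (adj (matrix G)) := by
  refine ⟨fun u v h => ?_, fun v => ?_⟩
  · rw [adj_matrix_iff] at *
    obtain ⟨hu, hv, h⟩ := h
    exact ⟨hv, hu, h.symm⟩
  · rw [← Bool.not_eq_true, adj_matrix_iff]
    rintro ⟨_, _, h⟩
    exact G.loopless.irrefl _ h

theorem card_filter_range {φ : Fin n → ℕ} {ψ : ℕ → ℕ} (h : ∀ v : Fin n, ψ v = φ v) (y : ℕ) :
    ((Finset.range n).filter fun v => ψ v = y).card =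
      (Finset.univ.filter fun v : Fin n => φ v = y).card := by
  rw [← Finset.card_image_of_injective _ Fin.val_injective]
  congr 1
  ext v
  simp only [Finset.mem_filter, Finset.mem_range, Finset.mem_image, Finset.mem_univ, true_and]
  constructor
  · rintro ⟨hv, e⟩
    exact ⟨⟨v, hv⟩, (h ⟨v, hv⟩).symm.trans e, rfl⟩
  · rintro ⟨w, e, rfl⟩
    exact ⟨w.2, (h w).trans e⟩

theorem getD_budgets {c : ℕ} (b : Fin c → ℕ) {y : ℕ} (hy : y < c) :
    (budgets n (binaryBudgets b)).getD y 0 = min (b ⟨y, hy⟩) n := by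
  simp [budgets, binaryBudgets, hy, capped_bits]

theorem length_budgets {c : ℕ} (b : Fin c → ℕ) : (budgets n (binaryBudgets b)).length = c := by
  simp [budgets, binaryBudgets]

/-- Capping the budgets is harmless because no color class has more than `n` vertices. -/
theorem isYes_iff (I : BCPInstance) : I.IsYes ↔ ∃ φ, IsValid (adj (matrix I.G)) (matrix I.G).length
    (budgets (matrix I.G).length (binaryBudgets I.b)) φ := by
  rw [length_matrix]
  constructor
  · rintro ⟨φ, hφ⟩
    let ψ : ℕ → ℕ := fun v => if h : v < I.n then φ ⟨v, h⟩ else 0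
    have hψ : ∀ v : Fin I.n, ψ v = (φ v : ℕ) := fun v => by simp [ψ]
    refine ⟨ψ, fun v hv => ?_, fun u _ v _ h => ?_, fun y hy => ?_⟩
    · rw [length_budgets, hψ ⟨v, hv⟩]
      exact (φ ⟨v, hv⟩).2
    · obtain ⟨hu, hv, h⟩ := (adj_matrix_iff I.G u v).1 h
      rw [hψ ⟨u, hu⟩, hψ ⟨v, hv⟩]
      exact fun e => φ.valid h (Fin.ext e)
    · rw [length_budgets] at hy
      rw [getD_budgets I.b hy, le_min_iff]
      refine ⟨?_, (Finset.card_filter_le _ _).trans (by simp)⟩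
      rw [card_filter_range hψ]
      refine le_trans (le_of_eq ?_) (hφ ⟨y, hy⟩)
      rw [← Set.ncard_coe_finset]
      congr 1
      ext v
      simp [SimpleGraph.Coloring.colorClass, Fin.ext_iff]
  · rintro ⟨ψ, h₁, h₂, h₃⟩
    rw [length_budgets] at h₁ h₃
    refine ⟨SimpleGraph.Coloring.mk (fun v => ⟨ψ v, h₁ v v.2⟩) fun {u v} h e => ?_, fun i => ?_⟩
    · exact h₂ u u.2 v v.2 ((adj_matrix_iff I.G u v).2 ⟨u.2, v.2, h⟩) (congrArg Fin.val e)
    · have := h₃ i i.2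
      rw [getD_budgets I.b i.2, card_filter_range (φ := fun v => ψ v) fun _ => rfl] at this
      refine le_trans (le_of_eq ?_) (this.trans (min_le_left _ _))
      rw [← Set.ncard_coe_finset]
      congr 1
      ext v
      simp only [SimpleGraph.Coloring.colorClass, Fin.ext_iff, Finset.coe_filter, Finset.mem_univ,
        true_and]
      exact Iff.rfl

variable {G}

/-- If there is no induced path on three vertices, adjacency propagates along walks, so every
component is a clique. -/
theorem isClusterDeletionSet_iff {S : Finset (Fin n)} {X : List ℕ}
    (hX : ∀ v : Fin n, v ∈ S ↔ (v : ℕ) ∈ X) :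
    IsClusterDeletionSet G S ↔ IsCluster (adj (matrix G)) n X := by
  constructor
  · intro h u hu v hv w hw huv hvw huw
    rw [mem_free] at hu hv hw
    obtain ⟨_, _, huv⟩ := (adj_matrix_iff G u v).1 huv
    obtain ⟨_, _, hvw⟩ := (adj_matrix_iff G v w).1 hvw
    have mem : ∀ (x : ℕ) (hx : x < n ∧ x ∉ X), (⟨x, hx.1⟩ : Fin n) ∈ ((↑S : Set (Fin n))ᶜ : Set (Fin n)) :=
      fun x hx h => hx.2 ((hX ⟨x, hx.1⟩).1 h)
    have a₁ : (deleteVerts G S).Adj ⟨_, mem u hu⟩ ⟨_, mem v hv⟩ := huv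
    have a₂ : (deleteVerts G S).Adj ⟨_, mem v hv⟩ ⟨_, mem w hw⟩ := hvw
    have := h _ _ (a₁.reachable.trans a₂.reachable) (by simpa using huw)
    exact (adj_matrix_iff G u w).2 ⟨hu.1, hw.1, this⟩
  · rintro h u v ⟨p⟩
    have mem : ∀ x : ((↑S : Set (Fin n))ᶜ : Set (Fin n)), ((x : Fin n) : ℕ) ∈ free n X :=
      fun x => mem_free.2 ⟨x.1.2, fun hx => x.2 ((hX x).2 hx)⟩
    induction p with
    | nil => intro hne; exact absurd rfl hne
    | @cons u v w huv p ih =>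
      intro huw
      by_cases hvw : v = w
      · exact hvw ▸ huv
      · have hvw := ih hvw
        have := h u (mem u) v (mem v) w (mem w) ((adj_matrix_iff G _ _).2 ⟨_, _, huv⟩)
          ((adj_matrix_iff G _ _).2 ⟨_, _, hvw⟩) fun e => huw (Subtype.ext (Fin.ext e))
        obtain ⟨_, _, h⟩ := (adj_matrix_iff G _ _).1 this
        exact h

/-- Distinct representatives lie in distinct components. This inequality suffices, as the number of
representatives enters only an upper bound for the time. -/
theorem length_reps_le_numClusters {S : Finset (Fin n)} {X : List ℕ}
    (hX : ∀ v : Fin n, v ∈ S ↔ (v : ℕ) ∈ X) (hS : IsClusterDeletionSet G S) :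
    (reps (adj (matrix G)) n X).length ≤ numClusters G S := by
  have hcl := (isClusterDeletionSet_iff hX).1 hS
  have hfree : ∀ q ∈ reps (adj (matrix G)) n X, q < n ∧ q ∉ X := fun q hq =>
    mem_free.1 (mem_reps.1 hq).1
  rw [← List.toFinset_card_of_nodup (nodup_reps _ _ _), numClusters, ← Fintype.card_coe,
    ← Nat.card_eq_fintype_card]
  have mem : ∀ q : (reps (adj (matrix G)) n X).toFinset, (q : ℕ) ∈ reps (adj (matrix G)) n X :=
    fun q => List.mem_toFinset.1 q.2
  have out : ∀ q : (reps (adj (matrix G)) n X).toFinset,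
      (⟨q, (hfree q (mem q)).1⟩ : Fin n) ∈ ((↑S : Set (Fin n))ᶜ : Set (Fin n)) :=
    fun q h => (hfree q (mem q)).2 ((hX _).1 h)
  refine Nat.card_le_card_of_injective
    (fun q => (deleteVerts G S).connectedComponentMk ⟨_, out q⟩) fun q r h => ?_
  by_contra hne
  have hqr : (q : ℕ) ≠ r := fun e => hne (Subtype.ext e)
  have hadj := hS _ _ (SimpleGraph.ConnectedComponent.exact h) (by simpa using hqr)
  obtain ⟨hq, hq'⟩ := mem_reps.1 (mem q)
  obtain ⟨hr, hr'⟩ := mem_reps.1 (mem r)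
  refine hqr ?_
  rw [← hq', ← hr', rep_eq_rep_iff (isGraph_matrix G) hcl hq hr]
  exact Or.inr ((adj_matrix_iff G _ _).2 ⟨_, _, hadj⟩)

/-- The minimum is taken over the lists of vertices as well. -/
theorem cvdNumber_le {X : List ℕ} (hX : X.Nodup) (hXn : ∀ v ∈ X, v < n)
    (hcl : IsCluster (adj (matrix G)) n X) : cvdNumber G ≤ X.length := by
  classical
  let S : Finset (Fin n) := Finset.univ.filter fun v => (v : ℕ) ∈ X
  have hS : ∀ v : Fin n, v ∈ S ↔ (v : ℕ) ∈ X := fun v => by simp [S]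
  have hcard : S.card = X.length := by
    rw [← List.toFinset_card_of_nodup hX, ← Finset.card_image_of_injective S Fin.val_injective]
    congr 1
    ext v
    simp only [Finset.mem_image, List.mem_toFinset]
    exact ⟨fun ⟨w, hw, e⟩ => e ▸ (hS w).1 hw, fun hv => ⟨⟨v, hXn v hv⟩, (hS _).2 hv, rfl⟩⟩
  rw [← hcard]
  exact Nat.sInf_le ⟨S, (isClusterDeletionSet_iff hS).2 hcl, rfl⟩

end

/-- For `k = 0` both sides are `1`, in line with the convention for the time bound. -/
theorem cast_pow_self (k : ℕ) : (2 : ℝ) ^ ((k : ℝ) * Real.logb 2 (k : ℝ)) = (k : ℝ) ^ k := by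
  rcases Nat.eq_zero_or_pos k with rfl | hk
  · simp
  · rw [mul_comm, Real.rpow_mul (by norm_num), Real.rpow_logb (by norm_num) (by norm_num)
      (by exact_mod_cast hk), Real.rpow_natCast]

theorem exists_cvd (G : SimpleGraph (Fin n)) :
    ∃ S : Finset (Fin n), IsClusterDeletionSet G S ∧ S.card = cvdNumber G :=
  Nat.sInf_mem (s := {k : ℕ | ∃ S : Finset (Fin n), IsClusterDeletionSet G S ∧ S.card = k})
    ⟨_, Finset.univ, fun u => absurd (Finset.mem_univ u.1) u.2, rfl⟩

theorem exists_decider :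
    ∃ (p : WhileLang.Prog) (C a : ℕ), ∀ I : BCPInstance,
      ∃ t : ℕ, WhileLang.Decides p I.encode I.IsYes t ∧
        ∀ S : Finset (Fin I.n), IsClusterDeletionSet I.G S → ∀ k d : ℕ,
          k = cvdNumber I.G → S.card = k → d = numClusters I.G S →
          (t : ℝ) ≤ (C : ℝ) * (I.encode.size : ℝ) ^ a *
            ((d : ℝ) ^ k * (2 : ℝ) ^ ((k : ℝ) * Real.logb 2 (k : ℝ))) := by
  obtain ⟨P, b, ⟨C, a, hb⟩, hP⟩ := exists_program
  have key : ∀ (I : BCPInstance) (S : Finset (Fin I.n)), IsClusterDeletionSet I.G S →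
      S.card = cvdNumber I.G → ∃ t : ℕ, Decides (P 0) I.encode I.IsYes t ∧
        t ≤ C * I.encode.size ^ a * (numClusters I.G S ^ S.card * S.card ^ S.card) := by
    intro I S hS hcard
    have hX : ∀ v : Fin I.n, v ∈ S ↔ (v : ℕ) ∈ S.toList.map Fin.val := fun v => by
      simp [Fin.val_inj]
    have hlen : (S.toList.map Fin.val).length = S.card := by simp
    have hcl := (isClusterDeletionSet_iff hX).1 hS
    obtain ⟨y, hm, hy⟩ := hP (matrix I.G) (binaryBudgets I.b) (S.toList.map Fin.val)
      (isGraph_matrix I.G) (S.nodup_toList.map Fin.val_injective)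
      (fun v hv => by
        obtain ⟨w, -, rfl⟩ := List.mem_map.1 hv
        rw [length_matrix]; exact w.2)
      (by rwa [length_matrix]) (fun X h₁ h₂ h₃ => by
        rw [length_matrix] at h₂ h₃
        rw [hlen, hcard]
        exact cvdNumber_le h₁ h₂ h₃)
    rw [← isYes_iff, ← encode_eq, hlen, length_matrix] at *
    obtain ⟨s, t, ht, hr, hs, -⟩ := hm 0 (initStore I.encode) rfl
    refine ⟨t, ⟨s, hr, by rw [hs, hy]⟩, ht.trans (Nat.mul_le_mul ?_ (Nat.mul_le_mul_right _
      (Nat.pow_le_pow_left (length_reps_le_numClusters hX hS) _)))⟩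
    refine (hb _).trans (le_of_eq ?_)
    rw [sz, ← encode_eq]
  refine ⟨P 0, C, a, fun I => ?_⟩
  -- The running time must be fixed before `S` is given. One minimum set provides it, and by
  -- determinism it is the same number that `key` bounds for every other minimum set.
  obtain ⟨S₀, hS₀, hcard₀⟩ := exists_cvd I.G
  obtain ⟨t, ⟨s, hr, hs⟩, -⟩ := key I S₀ hS₀ hcard₀
  refine ⟨t, ⟨s, hr, hs⟩, ?_⟩
  rintro S hS k d hk hSk rfl
  obtain ⟨t', ⟨s', hr', -⟩, ht'⟩ := key I S hS (hSk.trans hk)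
  rw [← (hr.unique hr').2, hSk] at ht'
  rw [cast_pow_self]
  exact_mod_cast ht'

end BudgetedColoring

theorem mainTheorem2 :
    ∃ (p : WhileLang.Prog) (C a : ℕ), ∀ I : BCPInstance,
      ∃ t : ℕ, WhileLang.Decides p I.encode I.IsYes t ∧
        ∀ S : Finset (Fin I.n), IsClusterDeletionSet I.G S → ∀ k d : ℕ,
          k = cvdNumber I.G → S.card = k → d = numClusters I.G S →
          (t : ℝ) ≤ (C : ℝ) * (I.encode.size : ℝ) ^ a *
            ((d : ℝ) ^ k * (2 : ℝ) ^ ((k : ℝ) * Real.logb 2 (k : ℝ))) :=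
  BudgetedColoring.exists_decider
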